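/- Let $A$ be a (unital) C*-algebra and $J$ an infinite set. For finite $F\subseteq J$ let $A_F=\bigotimes_{j\in F}A$ be the algebraic tensor power, equipped with either the minimal or the maximal C*-tensor norm (the same choice for all $F$), and for $F\subseteq G$ let $A_F\to A_G$ be the *-homomorphism inserting $1$ in the tensor factors indexed by $G\setminus F$. Let $A_J$ be the infinite tensor power of $A$, i.e. the C*-algebra obtained by completing $\operatorname{colim}_F A_F$ in the induced norm. For a permutation $\sigma$ of $J$ let $A_\sigma\colon A_J\to A_J$ be the *-homomorphism permuting the tensor factors according to $\sigma$. If $x\in A_J$ satisfies $A_\sigma(x)=x$ for every finite permutation $\sigma$ of $J$ (i.e. every permutation fixing all but finitely many elements of $J$), then $x=\lambda 1$ for some $\lambda\in\mathbb{C}$. -/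

import Mathlib

namespace CStarTensor

open scoped TensorProduct ComplexConjugate
open Function
open PiTensorProduct hiding tprod

universe u v

noncomputable section

section ConjLift

variable {ι : Type v} {s : ι → Type*} [∀ i, AddCommMonoid (s i)] [∀ i, Module ℂ (s i)]
  {E : Type*} [AddCommMonoid E] [Module ℂ E]

/-- The conjugate-linear map on `⨂ i, s i` induced by a map which is additive and
conjugate-homogeneous in each variable. -/
def conjLift (g : (Π i, s i) → E)
    (hadd : ∀ [DecidableEq ι] (m : Π i, s i) (i : ι) (x y : s i),
      g (update m i (x + y)) = g (update m i x) + g (update m i y))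
    (hsmul : ∀ [DecidableEq ι] (m : Π i, s i) (i : ι) (c : ℂ) (x : s i),
      g (update m i (c • x)) = conj c • g (update m i x)) :
    (⨂[ℂ] i, s i) →ₗ⋆[ℂ] E :=
  let φ : (⨂[ℂ] i, s i) →+ E := liftAddHom (fun p => conj p.1 • g p.2)
    (fun r f i hf => by
      classical
      have h := hsmul f i 0 0
      rw [smul_zero, ← hf, update_eq_self, map_zero, zero_smul] at h
      simp [h])
    (fun f => by simp)
    (fun r f i m₁ m₂ => by simp [hadd, smul_add])
    (fun r r' f => by simp [add_smul])
    (fun r f i r' => by simp [hsmul, smul_smul, mul_comm])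
  { φ with
    map_smul' := fun c x => by
      change φ (c • x) = conj c • φ x
      induction x using PiTensorProduct.induction_on' with
      | tprodCoeff r f =>
        rw [smul_tprodCoeff']
        change conj (c • r) • g f = conj c • conj r • g f
        simp [smul_smul]
      | add x y hx hy => rw [smul_add, map_add, map_add, hx, hy, smul_add] }

theorem conjLift_tprod (g : (Π i, s i) → E) (hadd) (hsmul) (a : Π i, s i) :
    conjLift g hadd hsmul (PiTensorProduct.tprod ℂ a) = g a := by
  rw [tprod_eq_tprodCoeff_one]
  change conj (1 : ℂ) • g a = g a
  simp

end ConjLift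

theorem extend_update {A ι κ : Type*} [One A] [DecidableEq ι] [DecidableEq κ] (e : ι ↪ κ) (m : ι → A) (i : ι) (z : A) :
    extend e (update m i z) (1 : κ → A) = update (extend e m (1 : κ → A)) (e i) z := by
  ext k
  by_cases hk : ∃ j, e j = k
  · obtain ⟨j, rfl⟩ := hk
    by_cases hj : j = i
    · subst hj; simp [e.injective.extend_apply]
    · have : e j ≠ e i := fun h => hj (e.injective h)
      simp [e.injective.extend_apply, hj]
  · have : k ≠ e i := fun h => hk ⟨i, h.symm⟩
    simp [extend_apply' _ _ _ hk, this]

/-! ### Algebraic tensor powers -/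

section Algebraic

/-- The algebraic tensor power `⨂ i : ι, A` over `ℂ`. -/
abbrev AlgPow (A : Type u) [Ring A] [Algebra ℂ A] (ι : Type v) : Type (max u v) := ⨂[ℂ] _ : ι, A

variable {A : Type u} [Ring A] [StarRing A] [Algebra ℂ A] [StarModule ℂ A] {ι κ : Type v}

/-- The involution `(⨂ a i)* = ⨂ (a i)*`. -/
instance : Star (AlgPow A ι) where
  star := conjLift (fun a : ι → A => PiTensorProduct.tprod ℂ (fun i => star (a i)))
    (fun m i x y => by
      have h : ∀ z : A, (fun j => star (update m i z j)) = update (fun j => star (m j)) i (star z) :=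
        fun z => by ext j; by_cases hj : j = i <;> [(subst hj; simp); simp [hj]]
      simp_rw [h, star_add, MultilinearMap.map_update_add])
    (fun m i c x => by
      have h : ∀ z : A, (fun j => star (update m i z j)) = update (fun j => star (m j)) i (star z) :=
        fun z => by ext j; by_cases hj : j = i <;> [(subst hj; simp); simp [hj]]
      simp_rw [h, star_smul, MultilinearMap.map_update_smul]; rfl)

theorem star_tprod (a : ι → A) :
    star (PiTensorProduct.tprod ℂ a : AlgPow A ι) = PiTensorProduct.tprod ℂ (fun i => star (a i)) :=
  conjLift_tprod _ _ _ a

theorem algPow_star_add (x y : AlgPow A ι) : star (x + y) = star x + star y :=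
  map_add (conjLift _ _ _) x y

theorem algPow_star_smul (c : ℂ) (x : AlgPow A ι) : star (c • x) = star c • star x :=
  map_smulₛₗ (conjLift _ _ _) c x

instance : StarRing (AlgPow A ι) where
  star_involutive x := by
    induction x using PiTensorProduct.induction_on with
    | smul_tprod c a => simp [algPow_star_smul, star_tprod]
    | add x y hx hy => rw [algPow_star_add, algPow_star_add, hx, hy]
  star_mul x y := by
    induction x using PiTensorProduct.induction_on with
    | smul_tprod c a =>
      induction y using PiTensorProduct.induction_on with
      | smul_tprod d b =>
        simp only [smul_mul_assoc, mul_smul_comm, tprod_mul_tprod, algPow_star_smul, star_tprod,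
          smul_smul]
        congr 1
        · simp [mul_comm]
        · congr 1
          ext i
          simp
      | add x y hx hy => rw [mul_add, algPow_star_add, hx, hy, algPow_star_add, add_mul]
    | add x y hx hy => rw [add_mul, algPow_star_add, hx, hy, algPow_star_add, mul_add]
  star_add := algPow_star_add

instance : StarModule ℂ (AlgPow A ι) where
  star_smul := algPow_star_smul

/-- The inclusion `AlgPow A ι → AlgPow A κ` along an injection `e : ι → κ`: it sends the tensor
factor at `i` to the one at `e i` and fills all the other tensor factors with `1`. -/
def AlgPow.incl (e : ι ↪ κ) : AlgPow A ι →⋆ₐ[ℂ] AlgPow A κ where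
  __ := liftAlgHom (R := ℂ) (A := fun _ : ι => A)
    { toFun := fun a => PiTensorProduct.tprod ℂ (extend e a (1 : κ → A))
      map_update_add' := fun m i x y => by
        classical
        simp only [extend_update, MultilinearMap.map_update_add]
      map_update_smul' := fun m i c x => by
        classical
        simp only [extend_update, MultilinearMap.map_update_smul] }
    (by
      change PiTensorProduct.tprod ℂ (extend e (1 : ι → A) (1 : κ → A)) = 1
      rw [one_def]
      congr 1
      exact extend_const e 1)
    (fun x y => by
      change PiTensorProduct.tprod ℂ (extend e (x * y) (1 : κ → A)) =
        PiTensorProduct.tprod ℂ (extend e x (1 : κ → A)) *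
          PiTensorProduct.tprod ℂ (extend e y (1 : κ → A))
      rw [tprod_mul_tprod, ← extend_mul, mul_one])
  map_star' := fun x => by
    change liftAlgHom _ _ _ (star x) = star (liftAlgHom _ _ _ x)
    induction x using PiTensorProduct.induction_on with
    | smul_tprod c a =>
      rw [star_smul, map_smul, map_smul, star_smul, star_tprod, liftAlgHom_apply, liftAlgHom_apply,
        lift.tprod, lift.tprod]
      change star c • PiTensorProduct.tprod ℂ (extend e (fun i => star (a i)) (1 : κ → A)) =
        star c • star (PiTensorProduct.tprod ℂ (extend e a (1 : κ → A)))
      rw [star_tprod]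
      congr 2
      ext k
      by_cases hk : ∃ j, e j = k
      · obtain ⟨j, rfl⟩ := hk
        simp [e.injective.extend_apply]
      · simp [extend_apply' _ _ _ hk]
    | add x y hx hy => rw [star_add, map_add, map_add, hx, hy, star_add]

@[simp]
theorem AlgPow.incl_tprod (e : ι ↪ κ) (a : ι → A) :
    AlgPow.incl e (PiTensorProduct.tprod ℂ a : AlgPow A ι) =
      PiTensorProduct.tprod ℂ (extend e a (1 : κ → A)) :=
  lift.tprod a

theorem AlgPow.incl_incl {μ : Type v} (e : ι ↪ κ) (e' : κ ↪ μ) (x : AlgPow A ι) :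
    AlgPow.incl e' (AlgPow.incl e x) = AlgPow.incl (e.trans e') x := by
  induction x using PiTensorProduct.induction_on with
  | smul_tprod c a =>
    simp only [map_smul, AlgPow.incl_tprod]
    congr 2
    ext k
    by_cases hk : ∃ j, e' j = k
    · obtain ⟨j, rfl⟩ := hk
      rw [e'.injective.extend_apply]
      by_cases hj : ∃ i, e i = j
      · obtain ⟨i, rfl⟩ := hj
        rw [e.injective.extend_apply]
        exact ((e.trans e').injective.extend_apply a 1 i).symm
      · rw [extend_apply' _ _ _ hj, extend_apply']
        · rfl
        · rintro ⟨i, hi⟩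
          exact hj ⟨i, e'.injective hi⟩
    · rw [extend_apply' _ _ _ hk, extend_apply']
      rintro ⟨i, hi⟩
      exact hk ⟨e i, hi⟩
  | add x y hx hy => simp only [map_add, hx, hy]

theorem AlgPow.incl_refl (e : ι ↪ ι) (he : ∀ i, e i = i) (x : AlgPow A ι) :
    AlgPow.incl e x = x := by
  induction x using PiTensorProduct.induction_on with
  | smul_tprod c a =>
    simp only [map_smul, AlgPow.incl_tprod]
    congr 2
    ext k
    have := e.injective.extend_apply a 1 k
    rwa [he] at this
  | add x y hx hy => simp only [map_add, hx, hy]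

end Algebraic

/-- A finite tensor power is generated, as an algebra, by its elements `1 ⊗ ⋯ ⊗ a ⊗ ⋯ ⊗ 1`. -/
theorem AlgPow.induction_single {A : Type u} [Ring A] [Algebra ℂ A] {ι : Type v} [Finite ι] [DecidableEq ι] {p : AlgPow A ι → Prop}
    (single : ∀ i a, p (singleAlgHom (R := ℂ) (A := fun _ : ι => A) i a))
    (smul : ∀ (c : ℂ) x, p x → p (c • x)) (one : p 1)
    (add : ∀ x y, p x → p y → p (x + y)) (mul : ∀ x y, p x → p y → p (x * y))
    (x : AlgPow A ι) : p x := by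
  cases nonempty_fintype ι
  have key : ∀ (a : ι → A) (s : Finset ι),
      p (PiTensorProduct.tprod ℂ (fun i => if i ∈ s then a i else 1)) := by
    intro a s
    induction s using Finset.induction_on with
    | empty => simpa [one_def, Pi.one_def] using! one
    | insert i s hi ih =>
      have := mul _ _ (single i (a i)) ih
      rw [singleAlgHom_apply, tprod_mul_tprod] at this
      convert! this using 2
      ext j
      by_cases hj : j = i
      · subst hj; simp [hi]
      · simp [hj]
  induction x using PiTensorProduct.induction_on with
  | smul_tprod c a => exact smul c _ (by simpa using key a Finset.univ)
  | add x y hx hy => exact add x y hx hy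



/-! ### Hilbert space tensor products -/

section Hilbert

variable {ι : Type v} (H : ι → Type u) [∀ i, NormedAddCommGroup (H i)]
  [∀ i, InnerProductSpace ℂ (H i)]

/-- The algebraic tensor product of a finite family of Hilbert spaces, with the inner product
`⟪⨂ v i, ⨂ w i⟫ = ∏ ⟪v i, w i⟫`. -/
def PreHilbertTensor : Type (max u v) := ⨂[ℂ] i, H i

instance : AddCommGroup (PreHilbertTensor H) := inferInstanceAs (AddCommGroup (⨂[ℂ] i, H i))
instance : Module ℂ (PreHilbertTensor H) := inferInstanceAs (Module ℂ (⨂[ℂ] i, H i))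

variable {H}

/-- The elementary tensor `⨂ v i`. -/
def PreHilbertTensor.mk (v : Π i, H i) : PreHilbertTensor H := PiTensorProduct.tprod ℂ v

@[elab_as_elim]
theorem PreHilbertTensor.induction {p : PreHilbertTensor H → Prop} (x : PreHilbertTensor H)
    (smul_mk : ∀ (c : ℂ) v, p (c • mk v)) (add : ∀ x y, p x → p y → p (x + y)) : p x :=
  PiTensorProduct.induction_on (R := ℂ) (s := H) (motive := p) x smul_mk add

theorem inner_update [DecidableEq ι] (m w : Π i, H i) (i : ι) (z : H i) :
    (fun j => inner ℂ (update m i z j) (w j)) =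
      update (fun j => inner ℂ (m j) (w j)) i (inner ℂ z (w i)) := by
  ext j
  by_cases hj : j = i
  · subst hj; simp
  · simp [hj]

theorem PreHilbertTensor.exists_sum (x : PreHilbertTensor H) :
    ∃ (n : ℕ) (c : Fin n → ℂ) (v : Fin n → Π i, H i), x = ∑ k, c k • mk (v k) := by
  induction x using PreHilbertTensor.induction with
  | smul_mk c v => exact ⟨1, fun _ => c, fun _ => v, by simp⟩
  | add x y hx hy =>
    obtain ⟨n, c, v, rfl⟩ := hx
    obtain ⟨m, d, w, rfl⟩ := hy
    exact ⟨n + m, Fin.append c d, Fin.append v w, by simp [Fin.sum_univ_add]⟩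

variable [Fintype ι]

/-- The sesquilinear form `⟪⨂ v i, ⨂ w i⟫ = ∏ ⟪v i, w i⟫`. -/
def PreHilbertTensor.form : PreHilbertTensor H →ₗ⋆[ℂ] PreHilbertTensor H →ₗ[ℂ] ℂ :=
  conjLift (s := H) (E := (⨂[ℂ] i, H i) →ₗ[ℂ] ℂ)
    (fun v => lift ((MultilinearMap.mkPiAlgebra ℂ ι ℂ).compLinearMap fun i => innerₛₗ ℂ (v i)))
    (fun m i x y => by
      refine PiTensorProduct.ext (MultilinearMap.ext fun w => ?_)
      have h := (MultilinearMap.mkPiAlgebra ℂ ι ℂ).map_update_add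
        (fun j => inner ℂ (m j) (w j)) i (inner ℂ x (w i)) (inner ℂ y (w i))
      rw [← inner_add_left, ← inner_update, ← inner_update, ← inner_update] at h
      simpa using! h)
    (fun m i c x => by
      refine PiTensorProduct.ext (MultilinearMap.ext fun w => ?_)
      have h := (MultilinearMap.mkPiAlgebra ℂ ι ℂ).map_update_smul
        (fun j => inner ℂ (m j) (w j)) i (conj c) (inner ℂ x (w i))
      rw [smul_eq_mul, ← inner_smul_left, ← inner_update, ← inner_update] at h
      simpa using! h)

theorem PreHilbertTensor.form_mk (v w : Π i, H i) :
    form (mk v) (mk w) = ∏ i, inner ℂ (v i) (w i) := by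
  have h : form (mk v) = lift ((MultilinearMap.mkPiAlgebra ℂ ι ℂ).compLinearMap
      fun i => innerₛₗ ℂ (v i)) := conjLift_tprod (s := H) (E := (⨂[ℂ] i, H i) →ₗ[ℂ] ℂ) _ _ _ v
  have h2 := LinearMap.congr_fun h (PiTensorProduct.tprod ℂ w)
  refine h2.trans ((lift.tprod _).trans ?_)
  simp

open scoped ComplexOrder in
theorem posSemidef_prod_gram {n κ : Type*} [Finite n] (s : Finset κ) {K : κ → Type*}
    [∀ i, NormedAddCommGroup (K i)] [∀ i, InnerProductSpace ℂ (K i)] (v : n → Π i, K i) :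
    (Matrix.of fun k l => ∏ i ∈ s, inner ℂ (v k i) (v l i)).PosSemidef := by
  classical
  induction s using Finset.induction_on with
  | empty =>
    convert! Matrix.posSemidef_gram ℂ (fun _ : n => (1 : ℂ)) using 1
    ext k l
    simp [Matrix.gram]
  | insert i s hi ih =>
    convert! (Matrix.posSemidef_gram ℂ (fun k => v k i)).hadamard ih using 1
    ext k l
    simp [Finset.prod_insert hi, Matrix.hadamard, Matrix.gram]

theorem PreHilbertTensor.form_conj (x y : PreHilbertTensor H) :
    conj (form y x) = form x y := by
  induction x using PreHilbertTensor.induction with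
  | smul_mk c v =>
    induction y using PreHilbertTensor.induction with
    | smul_mk d w => simp [form_mk, map_prod, inner_conj_symm]; ring
    | add x y hx hy => simp only [map_add, LinearMap.add_apply, hx, hy]
  | add x y hx hy => simp only [map_add, LinearMap.add_apply, hx, hy]

open scoped ComplexOrder in
theorem PreHilbertTensor.form_self_nonneg (x : PreHilbertTensor H) : 0 ≤ form x x := by
  obtain ⟨n, c, v, rfl⟩ := exists_sum x
  have h := (posSemidef_prod_gram Finset.univ v).dotProduct_mulVec_nonneg c
  convert! h using 1
  simp only [map_sum, LinearMap.sum_apply, map_smulₛₗ, LinearMap.smul_apply, form_mk, dotProduct,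
    Matrix.mulVec, Matrix.of_apply, Finset.mul_sum, smul_eq_mul, Pi.star_apply, RingHom.id_apply]
  rw [Finset.sum_comm]
  refine Finset.sum_congr rfl fun k _ => Finset.sum_congr rfl fun l _ => ?_
  simp only [Complex.star_def]
  ring

variable (H) in
/-- The tensor product pre-inner product. -/
abbrev PreHilbertTensor.core : PreInnerProductSpace.Core ℂ (PreHilbertTensor H) where
  inner x y := form x y
  conj_inner_symm x y := form_conj x y
  re_inner_nonneg x := by
    classical
    exact (Complex.le_def.1 (form_self_nonneg x)).1
  add_left x y z := by rw [map_add, LinearMap.add_apply]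
  smul_left x y c := by simp

instance : SeminormedAddCommGroup (PreHilbertTensor H) :=
  InnerProductSpace.Core.toSeminormedAddCommGroup (c := PreHilbertTensor.core H)

instance : InnerProductSpace ℂ (PreHilbertTensor H) :=
  InnerProductSpace.ofCore (PreHilbertTensor.core H)

theorem PreHilbertTensor.inner_mk (v w : Π i, H i) :
    inner ℂ (mk v) (mk w) = ∏ i, inner ℂ (v i) (w i) := form_mk v w

variable (H) in
/-- The Hilbert space tensor product of a finite family of Hilbert spaces. -/
abbrev HilbertTensor : Type (max u v) := UniformSpace.Completion (PreHilbertTensor H)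

end Hilbert

/-! ### Minimal and maximal norms -/

section Norms

/-- A (unital) `*`-representation of a complex `*`-algebra on a Hilbert space. -/
structure HilbertRep (B : Type*) [Ring B] [StarRing B] [Algebra ℂ B] where
  /-- The Hilbert space. -/
  space : Type u
  [normedAddCommGroup : NormedAddCommGroup space]
  [innerProductSpace : InnerProductSpace ℂ space]
  [completeSpace : CompleteSpace space]
  /-- The `*`-homomorphism to the bounded operators. -/
  hom : B →⋆ₐ[ℂ] (space →L[ℂ] space)

attribute [instance] HilbertRep.normedAddCommGroup HilbertRep.innerProductSpace
  HilbertRep.completeSpace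

instance (B : Type*) [Ring B] [StarRing B] [Algebra ℂ B] : Nonempty (HilbertRep.{u} B) :=
  ⟨{ space := PUnit
     hom :=
      { toFun := fun _ => 0
        map_one' := Subsingleton.elim _ _
        map_mul' := fun _ _ => Subsingleton.elim _ _
        map_zero' := Subsingleton.elim _ _
        map_add' := fun _ _ => Subsingleton.elim _ _
        commutes' := fun _ => Subsingleton.elim _ _
        map_star' := fun _ => Subsingleton.elim _ _ } }⟩

variable {A : Type u} [CStarAlgebra A] {ι κ : Type v}

/-- `a₁ ⊗ ⋯ ⊗ aₙ` acts on the algebraic tensor product of the Hilbert spaces of representations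
`π₁, …, πₙ` as `π₁(a₁) ⊗ ⋯ ⊗ πₙ(aₙ)`. -/
def preRep (R : ι → HilbertRep.{u} A) :
    AlgPow A ι →ₐ[ℂ] Module.End ℂ (PreHilbertTensor fun i => (R i).space) :=
  liftAlgHom (R := ℂ) (A := fun _ : ι => A) (S := Module.End ℂ (⨂[ℂ] i, (R i).space))
    ((mapMultilinear ℂ (fun i => (R i).space) (fun i => (R i).space)).compLinearMap fun i =>
      { toFun := fun a => ((R i).hom a : (R i).space →ₗ[ℂ] (R i).space)
        map_add' := fun a b => by rw [map_add]; rfl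
        map_smul' := fun c a => by rw [map_smul]; rfl })
    (by
      refine PiTensorProduct.ext (MultilinearMap.ext fun w => ?_)
      simp)
    (fun a b => by
      refine PiTensorProduct.ext (MultilinearMap.ext fun w => ?_)
      simp)

theorem preRep_tprod_mk (R : ι → HilbertRep.{u} A) (a : ι → A) (w : Π i, (R i).space) :
    preRep R (PiTensorProduct.tprod ℂ a) (PreHilbertTensor.mk w) =
      PreHilbertTensor.mk fun i => (R i).hom (a i) (w i) := by
  have h : preRep R (PiTensorProduct.tprod ℂ a) = PiTensorProduct.map (R := ℂ)
    fun i => ((R i).hom (a i) : (R i).space →ₗ[ℂ] (R i).space) :=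
    lift.tprod (E := Module.End ℂ (⨂[ℂ] i, (R i).space)) a
  rw [h]
  exact PiTensorProduct.map_tprod _ w

variable [Fintype ι] [Fintype κ]

theorem preRep_adjoint (R : ι → HilbertRep.{u} A) (x : AlgPow A ι)
    (ξ η : PreHilbertTensor fun i => (R i).space) :
    inner ℂ ξ (preRep R x η) = inner ℂ (preRep R (star x) ξ) η := by
  induction x using PiTensorProduct.induction_on with
  | smul_tprod c a =>
    induction ξ using PreHilbertTensor.induction with
    | smul_mk d v =>
      induction η using PreHilbertTensor.induction with
      | smul_mk e w =>
        simp only [star_smul, star_tprod, map_smul, LinearMap.smul_apply, preRep_tprod_mk,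
          inner_smul_left, inner_smul_right, PreHilbertTensor.inner_mk, map_star,
          ContinuousLinearMap.star_eq_adjoint, ContinuousLinearMap.adjoint_inner_left]
        simp only [Complex.star_def, Complex.conj_conj]
        ring
      | add x y hx hy => simp only [map_add, inner_add_right, hx, hy]
    | add x y hx hy => simp only [map_add, inner_add_left, hx, hy]
  | add x y hx hy =>
    simp only [map_add, star_add, LinearMap.add_apply, inner_add_left, inner_add_right, hx, hy]

theorem preRep_bounded (R : ι → HilbertRep.{u} A) (x : AlgPow A ι) :
    ∃ C : ℝ, ∀ ξ, ‖preRep R x ξ‖ ≤ C * ‖ξ‖ := by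
  classical
  suffices h : ∃ C : ℝ, 0 ≤ C ∧ ∀ ξ, ‖preRep R x ξ‖ ≤ C * ‖ξ‖ by
    obtain ⟨C, -, h⟩ := h
    exact ⟨C, h⟩
  have hsmul : ∀ (c : ℂ) (x : AlgPow A ι), (∃ C : ℝ, 0 ≤ C ∧ ∀ ξ, ‖preRep R x ξ‖ ≤ C * ‖ξ‖) →
      ∃ C : ℝ, 0 ≤ C ∧ ∀ ξ, ‖preRep R (c • x) ξ‖ ≤ C * ‖ξ‖ := by
    rintro c x ⟨C, hC, h⟩
    refine ⟨‖c‖ * C, by positivity, fun ξ => ?_⟩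
    rw [map_smul, LinearMap.smul_apply, norm_smul, mul_assoc]
    gcongr
    exact h ξ
  have hadd : ∀ (x y : AlgPow A ι), (∃ C : ℝ, 0 ≤ C ∧ ∀ ξ, ‖preRep R x ξ‖ ≤ C * ‖ξ‖) →
      (∃ C : ℝ, 0 ≤ C ∧ ∀ ξ, ‖preRep R y ξ‖ ≤ C * ‖ξ‖) →
      ∃ C : ℝ, 0 ≤ C ∧ ∀ ξ, ‖preRep R (x + y) ξ‖ ≤ C * ‖ξ‖ := by
    rintro x y ⟨C, hC, h⟩ ⟨D, hD, h'⟩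
    refine ⟨C + D, by positivity, fun ξ => ?_⟩
    rw [map_add, LinearMap.add_apply, add_mul]
    exact (norm_add_le _ _).trans (add_le_add (h ξ) (h' ξ))
  induction x using AlgPow.induction_single with
  | single i a =>
    have ha : a ∈ Submodule.span ℂ (unitary A : Set A) := by
      rw [CStarAlgebra.span_unitary]; trivial
    induction ha using Submodule.span_induction with
    | mem u hu =>
      refine ⟨1, zero_le_one, fun ξ => ?_⟩
      set y := singleAlgHom (R := ℂ) (A := fun _ : ι => A) i u with hy
      have hyy : star y * y = 1 := by
        rw [hy, singleAlgHom_apply, star_tprod, tprod_mul_tprod, one_def]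
        congr 1
        ext j
        by_cases hj : j = i
        · subst hj; simp [(Unitary.mem_iff.1 hu).1]
        · simp [hj]
      have h : inner ℂ (preRep R y ξ) (preRep R y ξ) = inner ℂ ξ ξ := by
        rw [preRep_adjoint, ← Module.End.mul_apply, ← map_mul, hyy, map_one, Module.End.one_apply]
      rw [one_mul, @norm_eq_sqrt_re_inner ℂ, @norm_eq_sqrt_re_inner ℂ _ _ _ _ ξ, h]
    | zero => exact ⟨0, le_rfl, fun ξ => by rw [map_zero]; simp⟩
    | add a b _ _ ha hb => rw [map_add]; exact hadd _ _ ha hb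
    | smul c a _ ha => rw [map_smul]; exact hsmul _ _ ha
  | smul c x hx => exact hsmul c x hx
  | one => exact ⟨1, zero_le_one, fun ξ => by simp⟩
  | add x y hx hy => exact hadd x y hx hy
  | mul x y hx hy =>
    obtain ⟨C, hC, h⟩ := hx
    obtain ⟨D, hD, h'⟩ := hy
    refine ⟨C * D, by positivity, fun ξ => ?_⟩
    rw [map_mul, Module.End.mul_apply, mul_assoc]
    exact (h _).trans (by gcongr; exact h' ξ)

/-- The bounded operator on the algebraic tensor product of Hilbert spaces given by `preRep`. -/
def preRepL (R : ι → HilbertRep.{u} A) (x : AlgPow A ι) :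
    (PreHilbertTensor fun i => (R i).space) →L[ℂ] PreHilbertTensor fun i => (R i).space :=
  (preRep R x).mkContinuousOfExistsBound (preRep_bounded R x)

@[simp]
theorem preRepL_apply (R : ι → HilbertRep.{u} A) (x : AlgPow A ι)
    (ξ : PreHilbertTensor fun i => (R i).space) : preRepL R x ξ = preRep R x ξ := rfl

open UniformSpace in
/-- The tensor product representation `π₁ ⊗ ⋯ ⊗ πₙ` of `A ⊗ ⋯ ⊗ A` on the Hilbert space tensor
product of the Hilbert spaces of the representations `π₁, …, πₙ` of `A`. -/
def spatialRep (R : ι → HilbertRep.{u} A) : HilbertRep.{max u v} (AlgPow A ι) where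
  space := HilbertTensor fun i => (R i).space
  hom :=
    { toFun := fun x => (preRepL R x).completion
      map_one' := by
        ext c
        induction c using Completion.induction_on with
        | hp => apply isClosed_eq <;> fun_prop
        | ih c => simp
      map_mul' := fun x y => by
        ext c
        induction c using Completion.induction_on with
        | hp => apply isClosed_eq <;> fun_prop
        | ih c => simp
      map_zero' := by
        ext c
        induction c using Completion.induction_on with
        | hp => apply isClosed_eq <;> fun_prop
        | ih c => simp [Completion.coe_zero]
      map_add' := fun x y => by
        ext c
        induction c using Completion.induction_on with
        | hp => apply isClosed_eq <;> fun_prop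
        | ih c => simp [Completion.coe_add]
      commutes' := fun r => by
        ext c
        induction c using Completion.induction_on with
        | hp => apply isClosed_eq <;> fun_prop
        | ih c => simp [Algebra.algebraMap_eq_smul_one]
      map_star' := fun x => by
        refine (ContinuousLinearMap.eq_adjoint_iff _ _).mpr fun ξ η => ?_
        induction ξ, η using Completion.induction_on₂ with
        | hp => apply isClosed_eq <;> fun_prop
        | ih ξ η =>
          simp only [ContinuousLinearMap.completion_apply_coe, preRepL_apply,
            Completion.inner_coe]
          exact (preRep_adjoint R x ξ η).symm }

end Norms

section Norms

variable {A : Type u} [CStarAlgebra A] {ι κ : Type v} [Fintype ι] [Fintype κ]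

theorem prod_split (e : ι ↪ κ) (f : κ → ℂ) [DecidableEq κ] :
    ∏ k, f k = (∏ i, f (e i)) * ∏ k ∈ (Finset.univ.map e)ᶜ, f k := by
  rw [← Finset.prod_mul_prod_compl (Finset.univ.map e) f, Finset.prod_map]

theorem inner_preRep_incl [DecidableEq κ] (e : ι ↪ κ) (S : κ → HilbertRep.{u} A)
    (y : AlgPow A ι) (v w : Π k, (S k).space) :
    inner ℂ (PreHilbertTensor.mk v) (preRep S (AlgPow.incl e y) (PreHilbertTensor.mk w)) =
      inner ℂ (PreHilbertTensor.mk fun i => v (e i))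
        (preRep (fun i => S (e i)) y (PreHilbertTensor.mk fun i => w (e i))) *
      ∏ k ∈ (Finset.univ.map e)ᶜ, inner ℂ (v k) (w k) := by
  induction y using PiTensorProduct.induction_on with
  | smul_tprod c a =>
    simp only [map_smul, LinearMap.smul_apply, AlgPow.incl_tprod, preRep_tprod_mk,
      inner_smul_right, PreHilbertTensor.inner_mk]
    have h1 : ∀ i, inner ℂ (v (e i)) ((S (e i)).hom (extend e a 1 (e i)) (w (e i))) =
        inner ℂ (v (e i)) ((S (e i)).hom (a i) (w (e i))) := fun i => by
      rw [e.injective.extend_apply]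
    have h2 : ∀ k ∈ (Finset.univ.map e)ᶜ, inner ℂ (v k) ((S k).hom (extend e a 1 k) (w k)) =
        inner ℂ (v k) (w k) := fun k hk => by
      rw [extend_apply']
      · simp
      · rintro ⟨i, rfl⟩
        simp at hk
    rw [prod_split e, Finset.prod_congr rfl h2, mul_assoc]
    simp only [h1]
  | add x y hx hy =>
    simp only [map_add, LinearMap.add_apply, inner_add_right, hx, hy, add_mul]

open scoped ComplexOrder in
theorem norm_preRep_incl_le (e : ι ↪ κ) (S : κ → HilbertRep.{u} A) (x : AlgPow A ι)
    (ξ : PreHilbertTensor fun k => (S k).space) :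
    ‖preRep S (AlgPow.incl e x) ξ‖ ≤ ‖(spatialRep fun i => S (e i)).hom x‖ * ‖ξ‖ := by
  classical
  set f := (spatialRep fun i => S (e i)).hom x with hf
  obtain ⟨n, c, v, rfl⟩ := PreHilbertTensor.exists_sum ξ
  set ξ := ∑ k, c k • PreHilbertTensor.mk (v k)
  let w : Fin n → (spatialRep fun i => S (e i)).space := fun k =>
    ((PreHilbertTensor.mk fun i => v k (e i) : PreHilbertTensor fun i => (S (e i)).space) :
      HilbertTensor fun i => (S (e i)).space)
  have h := ((Matrix.posSemidef_opNorm_smul_gram_sub_gram (𝕜 := ℂ) w f).hadamard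
    (posSemidef_prod_gram (Finset.univ.map e)ᶜ v)).dotProduct_mulVec_nonneg c
  have hfw : ∀ k l, inner ℂ (f (w k)) (f (w l)) =
      inner ℂ (PreHilbertTensor.mk fun i => v k (e i))
        (preRep (fun i => S (e i)) (star x * x) (PreHilbertTensor.mk fun i => v l (e i))) := by
    intro k l
    rw [map_mul, Module.End.mul_apply, preRep_adjoint, star_star]
    have : ∀ k, f (w k) = ((preRep (fun i => S (e i)) x (PreHilbertTensor.mk fun i => v k (e i)) :
        PreHilbertTensor fun i => (S (e i)).space) :
          HilbertTensor fun i => (S (e i)).space) := fun k =>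
      ContinuousLinearMap.completion_apply_coe (preRepL (fun i => S (e i)) x) _
    rw [this, this]
    exact UniformSpace.Completion.inner_coe _ _
  have hw : ∀ k l, inner ℂ (w k) (w l) = ∏ i, inner ℂ (v k (e i)) (v l (e i)) := fun k l =>
    (UniformSpace.Completion.inner_coe _ _).trans (PreHilbertTensor.inner_mk _ _)
  have key : star c ⬝ᵥ (((‖f‖ ^ 2 • Matrix.gram ℂ w - Matrix.gram ℂ (f ∘ w)).hadamard
      (Matrix.of fun k l => ∏ i ∈ (Finset.univ.map e)ᶜ, inner ℂ (v k i) (v l i))).mulVec c) =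
      (‖f‖ ^ 2 : ℝ) * inner ℂ ξ ξ - inner ℂ (preRep S (AlgPow.incl e x) ξ)
        (preRep S (AlgPow.incl e x) ξ) := by
    have h1 : inner ℂ (preRep S (AlgPow.incl e x) ξ) (preRep S (AlgPow.incl e x) ξ) =
        inner ℂ ξ (preRep S (AlgPow.incl e (star x * x)) ξ) := by
      rw [map_mul, map_mul, Module.End.mul_apply, preRep_adjoint S (AlgPow.incl e (star x)),
        ← map_star, star_star]
    rw [h1]
    simp only [ξ, map_sum, map_smul, sum_inner, inner_sum, inner_smul_left, inner_smul_right,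
      inner_preRep_incl, dotProduct, Matrix.mulVec, Matrix.hadamard, Matrix.of_apply,
      Matrix.sub_apply, Matrix.smul_apply, Matrix.gram_apply, Function.comp_apply, hfw, hw,
      PreHilbertTensor.inner_mk, Finset.mul_sum, ← Finset.sum_sub_distrib]
    rw [Finset.sum_comm]
    refine Finset.sum_congr rfl fun k _ => Finset.sum_congr rfl fun l _ => ?_
    rw [prod_split e]
    simp only [Pi.star_apply, Complex.star_def, Complex.real_smul]
    ring
  rw [key, inner_self_eq_norm_sq_to_K, inner_self_eq_norm_sq_to_K] at h
  have h' : 0 ≤ ‖f‖ ^ 2 * ‖ξ‖ ^ 2 - ‖preRep S (AlgPow.incl e x) ξ‖ ^ 2 := by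
    simp only [Complex.coe_algebraMap] at h
    exact_mod_cast h
  refine (sq_le_sq₀ (by positivity) (by positivity)).1 ?_
  rw [mul_pow]
  linarith

open UniformSpace in
theorem norm_spatialRep_incl_le (e : ι ↪ κ) (S : κ → HilbertRep.{u} A) (x : AlgPow A ι) :
    ‖(spatialRep S).hom (AlgPow.incl e x)‖ ≤ ‖(spatialRep fun i => S (e i)).hom x‖ := by
  refine ContinuousLinearMap.opNorm_le_bound _ (norm_nonneg _) fun ξ => ?_
  induction ξ using Completion.induction_on with
  | hp => apply isClosed_le <;> fun_prop
  | ih ξ =>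
    have h : (spatialRep S).hom (AlgPow.incl e x) (ξ : HilbertTensor fun k => (S k).space) =
        ((preRep S (AlgPow.incl e x) ξ : PreHilbertTensor fun k => (S k).space) :
          HilbertTensor fun k => (S k).space) :=
      ContinuousLinearMap.completion_apply_coe (preRepL S (AlgPow.incl e x)) ξ
    rw [h]
    refine (Completion.norm_coe _).trans_le ((norm_preRep_incl_le e S x ξ).trans_eq ?_)
    exact congrArg _ (Completion.norm_coe ξ).symm

/-- The two standard `C*`-norms on tensor products of `C*`-algebras: the minimal (spatial) and the
maximal one. -/
inductive TensorNorm
  | min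
  | max

/-- The representations of `A ⊗ ⋯ ⊗ A` defining a tensor norm: tensor products of representations
of `A` for the minimal norm, and arbitrary representations for the maximal norm. -/
def TensorNorm.reps (A : Type u) [CStarAlgebra A] (ι : Type v) [Fintype ι] :
    TensorNorm → Set (HilbertRep.{max u v} (AlgPow A ι))
  | .min => Set.range fun R : ι → HilbertRep.{u} A => spatialRep R
  | .max => Set.univ

/-- The minimal or maximal norm of an element of the algebraic tensor power. -/
def tensorNorm (t : TensorNorm) (x : AlgPow A ι) : ℝ :=
  ⨆ R : t.reps A ι, ‖R.1.hom x‖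

instance (t : TensorNorm) : Nonempty (t.reps A ι) := by
  cases t with
  | min => exact ⟨⟨_, Set.mem_range_self fun _ => Classical.arbitrary _⟩⟩
  | max => exact ⟨⟨Classical.arbitrary _, trivial⟩⟩

theorem exists_rep_bound (x : AlgPow A ι) :
    ∃ C : ℝ, 0 ≤ C ∧ ∀ R : HilbertRep.{max u v} (AlgPow A ι), ‖R.hom x‖ ≤ C := by
  classical
  induction x using AlgPow.induction_single with
  | single i a =>
    refine ⟨‖a‖, norm_nonneg a, fun R => ?_⟩
    let φ : A →⋆ₐ[ℂ] (R.space →L[ℂ] R.space) :=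
      { (R.hom : AlgPow A ι →ₐ[ℂ] (R.space →L[ℂ] R.space)).comp
          (singleAlgHom (R := ℂ) (A := fun _ : ι => A) i) with
        map_star' := fun a => by
          change R.hom _ = star (R.hom _)
          rw [← map_star]
          congr 1
          simp only [RingHom.coe_coe, singleAlgHom_apply, star_tprod]
          congr 1
          ext j
          by_cases hj : j = i
          · subst hj; simp
          · simp [hj] }
    exact NonUnitalStarAlgHom.norm_apply_le φ a
  | smul c x hx =>
    obtain ⟨C, hC, h⟩ := hx
    refine ⟨‖c‖ * C, by positivity, fun R => ?_⟩
    rw [map_smul, norm_smul]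
    gcongr
    exact h R
  | one =>
    refine ⟨1, zero_le_one, fun R => ?_⟩
    rw [map_one]
    exact ContinuousLinearMap.norm_id_le
  | add x y hx hy =>
    obtain ⟨C, hC, h⟩ := hx
    obtain ⟨D, hD, h'⟩ := hy
    refine ⟨C + D, by positivity, fun R => ?_⟩
    rw [map_add]
    exact (norm_add_le _ _).trans (add_le_add (h R) (h' R))
  | mul x y hx hy =>
    obtain ⟨C, hC, h⟩ := hx
    obtain ⟨D, hD, h'⟩ := hy
    refine ⟨C * D, by positivity, fun R => ?_⟩
    rw [map_mul]
    exact (norm_mul_le _ _).trans (mul_le_mul (h R) (h' R) (norm_nonneg _) hC)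

theorem bddAbove_rep (t : TensorNorm) (x : AlgPow A ι) :
    BddAbove (Set.range fun R : t.reps A ι => ‖R.1.hom x‖) := by
  obtain ⟨C, -, h⟩ := exists_rep_bound x
  exact ⟨C, by rintro _ ⟨R, rfl⟩; exact h R.1⟩

theorem norm_le_tensorNorm (t : TensorNorm) {R : HilbertRep.{max u v} (AlgPow A ι)}
    (hR : R ∈ t.reps A ι) (x : AlgPow A ι) : ‖R.hom x‖ ≤ tensorNorm t x :=
  le_ciSup (bddAbove_rep t x) ⟨R, hR⟩

theorem tensorNorm_nonneg (t : TensorNorm) (x : AlgPow A ι) : 0 ≤ tensorNorm t x :=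
  Real.iSup_nonneg fun _ => norm_nonneg _

theorem tensorNorm_zero (t : TensorNorm) : tensorNorm t (0 : AlgPow A ι) = 0 := by
  simp [tensorNorm]

theorem tensorNorm_add_le (t : TensorNorm) (x y : AlgPow A ι) :
    tensorNorm t (x + y) ≤ tensorNorm t x + tensorNorm t y :=
  ciSup_le fun R => by
    rw [map_add]
    exact (norm_add_le _ _).trans
      (add_le_add (norm_le_tensorNorm t R.2 x) (norm_le_tensorNorm t R.2 y))

theorem tensorNorm_smul (t : TensorNorm) (c : ℂ) (x : AlgPow A ι) :
    tensorNorm t (c • x) = ‖c‖ * tensorNorm t x := by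
  simp only [tensorNorm, map_smul, norm_smul]
  exact (Real.mul_iSup_of_nonneg (norm_nonneg c) _).symm

theorem tensorNorm_mul_le (t : TensorNorm) (x y : AlgPow A ι) :
    tensorNorm t (x * y) ≤ tensorNorm t x * tensorNorm t y :=
  ciSup_le fun R => by
    rw [map_mul]
    exact (norm_mul_le _ _).trans (mul_le_mul (norm_le_tensorNorm t R.2 x)
      (norm_le_tensorNorm t R.2 y) (norm_nonneg _) (tensorNorm_nonneg t x))

theorem tensorNorm_star (t : TensorNorm) (x : AlgPow A ι) :
    tensorNorm t (star x) = tensorNorm t x := by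
  simp only [tensorNorm, map_star, norm_star]

theorem tensorNorm_sq_le (t : TensorNorm) (x : AlgPow A ι) :
    tensorNorm t x * tensorNorm t x ≤ tensorNorm t (star x * x) := by
  have h : tensorNorm t x ≤ √(tensorNorm t (star x * x)) := ciSup_le fun R => by
    refine Real.le_sqrt_of_sq_le ?_
    rw [sq, ← CStarRing.norm_star_mul_self, ← map_star, ← map_mul]
    exact norm_le_tensorNorm t R.2 _
  calc _ ≤ _ := mul_self_le_mul_self (tensorNorm_nonneg t x) h
    _ = _ := Real.mul_self_sqrt (tensorNorm_nonneg t _)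

theorem tensorNorm_incl_le (t : TensorNorm) (e : ι ↪ κ) (x : AlgPow A ι) :
    tensorNorm t (AlgPow.incl e x) ≤ tensorNorm t x :=
  ciSup_le fun R => by
    obtain ⟨R, hR⟩ := R
    cases t with
    | min =>
      obtain ⟨S, rfl⟩ := hR
      exact (norm_spatialRep_incl_le e S x).trans
        (norm_le_tensorNorm .min (Set.mem_range_self fun i => S (e i)) x)
    | max =>
      exact norm_le_tensorNorm .max
        (R := { space := R.space, hom := R.hom.comp (AlgPow.incl e) }) trivial x

end Norms

/-! ### Infinite tensor powers -/

section Infinite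

/-- The inclusion of a finite set of indices into a larger one. -/
def subEmb {J : Type v} {F G : Finset J} (h : F ≤ G) : F ↪ G :=
  ⟨fun i => ⟨i.1, h i.2⟩, fun _ _ hij => Subtype.ext (congrArg (fun k : G => k.1) hij)⟩

/-- The restriction of a permutation `σ` to a finite set of indices `F`, as a map to `σ(F)`. -/
def permEmb {J : Type v} (σ : Equiv.Perm J) (F : Finset J) : F ↪ F.map σ.toEmbedding :=
  ⟨fun i => ⟨σ i.1, Finset.mem_map_of_mem _ i.2⟩,
    fun _ _ hij => Subtype.ext (σ.injective (congrArg (fun k : F.map σ.toEmbedding => k.1) hij))⟩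

variable (t : TensorNorm) (A : Type u) [CStarAlgebra A] (J : Type v)

/-- The transition maps `A_F → A_G` for finite sets of indices `F ⊆ G`. -/
def transition (F G : Finset J) (h : F ≤ G) : AlgPow A F →⋆ₐ[ℂ] AlgPow A G :=
  AlgPow.incl (subEmb h)

instance : DirectedSystem (fun F : Finset J => AlgPow A F) (transition A J · · ·) where
  map_self _ x := AlgPow.incl_refl _ (fun _ => rfl) x
  map_map _ _ _ h h' x := AlgPow.incl_incl (subEmb h) (subEmb h') x

/-- The colimit `colim_F A_F` over the finite subsets `F ⊆ J` of the algebraic tensor powers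
`A_F = ⨂ i : F, A`. It is equipped with the norm induced by the minimal or maximal norms on the
`A_F`. -/
def PreTensorPower (_t : TensorNorm) (A : Type u) [CStarAlgebra A] (J : Type v) :
    Type (max u v) :=
  DirectLimit (fun F : Finset J => AlgPow A F) (transition A J)

namespace PreTensorPower

instance : Ring (PreTensorPower t A J) :=
  inferInstanceAs (Ring (DirectLimit (fun F : Finset J => AlgPow A F) (transition A J)))
instance : StarRing (PreTensorPower t A J) where
  toStarMul := inferInstanceAs (StarMul (DirectLimit (fun F : Finset J => AlgPow A F) (transition A J)))
  star_add := star_add (R := DirectLimit (fun F : Finset J => AlgPow A F) (transition A J))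
instance : Algebra ℂ (PreTensorPower t A J) :=
  inferInstanceAs (Algebra ℂ (DirectLimit (fun F : Finset J => AlgPow A F) (transition A J)))
instance : StarModule ℂ (PreTensorPower t A J) :=
  inferInstanceAs (StarModule ℂ (DirectLimit (fun F : Finset J => AlgPow A F) (transition A J)))

variable {A J}

/-- The canonical map `A_F → colim_F A_F`. -/
def of (F : Finset J) : AlgPow A F →⋆ₐ[ℂ] PreTensorPower t A J where
  toFun x := (⟦⟨F, x⟩⟧ : DirectLimit (fun F : Finset J => AlgPow A F) (transition A J))
  map_one' := (DirectLimit.one_def F).symm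
  map_mul' x y := (DirectLimit.mul_def (f := transition A J) F x y).symm
  map_zero' := (DirectLimit.zero_def F).symm
  map_add' x y := (DirectLimit.add_def (f := transition A J) F x y).symm
  commutes' r := (DirectLimit.algebraMap_def F r).symm
  map_star' _ := rfl

theorem of_transition {F G : Finset J} (h : F ≤ G) (x : AlgPow A F) :
    of t G (transition A J F G h x) = of t F x :=
  DirectLimit.mk_apply (f := transition A J) _ _ _ h

theorem exists_of (z : PreTensorPower t A J) : ∃ F x, z = of t F x :=
  let ⟨F, x, h⟩ := DirectLimit.exists_eq_mk (transition A J) z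
  ⟨F, x, h⟩

theorem exists_of₂ (z w : PreTensorPower t A J) : ∃ F x y, z = of t F x ∧ w = of t F y :=
  let ⟨F, x, y, h, h'⟩ := DirectLimit.exists_eq_mk₂ (transition A J) z w
  ⟨F, x, y, h, h'⟩

theorem of_eq_of {F G : Finset J} {x : AlgPow A F} {y : AlgPow A G} (h : of t F x = of t G y) :
    ∃ (K : Finset J) (hF : F ≤ K) (hG : G ≤ K),
      transition A J F K hF x = transition A J G K hG y :=
  let ⟨K, hF, hG, h⟩ := Quotient.exact h
  ⟨K, hF, hG, h⟩

/-- The norm on the colimit: the infimum, which is also the limit along the finite subsets of `J`,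
of the norms of the representatives in the finite tensor powers. -/
instance : Norm (PreTensorPower t A J) where
  norm z := sInf {r | ∃ (F : Finset J) (x : AlgPow A F), of t F x = z ∧ tensorNorm t x = r}

variable {t}

theorem norm_of_le {F : Finset J} (x : AlgPow A F) : ‖of t F x‖ ≤ tensorNorm t x :=
  csInf_le ⟨0, by rintro _ ⟨F, x, -, rfl⟩; exact tensorNorm_nonneg t x⟩ ⟨F, x, rfl, rfl⟩

theorem le_norm {z : PreTensorPower t A J} {r : ℝ}
    (h : ∀ (F : Finset J) (x : AlgPow A F), of t F x = z → r ≤ tensorNorm t x) : r ≤ ‖z‖ := by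
  obtain ⟨F, x, rfl⟩ := exists_of t z
  exact le_csInf ⟨_, F, x, rfl, rfl⟩ (by rintro _ ⟨G, y, hy, rfl⟩; exact h G y hy)

theorem norm_nonneg' (z : PreTensorPower t A J) : 0 ≤ ‖z‖ :=
  le_norm fun _ x _ => tensorNorm_nonneg t x

theorem tensorNorm_transition_le {F G : Finset J} (h : F ≤ G) (x : AlgPow A F) :
    tensorNorm t (transition A J F G h x) ≤ tensorNorm t x :=
  tensorNorm_incl_le t _ x

/-- Two elements of the colimit have common representatives of almost minimal norms. -/
theorem exists_norm_lt (z w : PreTensorPower t A J) {r s : ℝ} (hr : ‖z‖ < r) (hs : ‖w‖ < s) :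
    ∃ (F : Finset J) (x y : AlgPow A F), of t F x = z ∧ of t F y = w ∧
      tensorNorm t x < r ∧ tensorNorm t y < s := by
  have key : ∀ (z : PreTensorPower t A J) {r : ℝ}, ‖z‖ < r →
      ∃ (F : Finset J) (x : AlgPow A F), of t F x = z ∧ tensorNorm t x < r := by
    intro z r hr
    by_contra! hcon
    exact absurd (le_norm hcon) (not_le.2 hr)
  classical
  obtain ⟨F, x, hx, hxr⟩ := key z hr
  obtain ⟨G, y, hy, hys⟩ := key w hs
  exact ⟨F ⊔ G, transition A J _ _ le_sup_left x, transition A J _ _ le_sup_right y,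
    (of_transition t _ x).trans hx, (of_transition t _ y).trans hy,
    (tensorNorm_transition_le _ x).trans_lt hxr, (tensorNorm_transition_le _ y).trans_lt hys⟩

theorem norm_add_le' (z w : PreTensorPower t A J) : ‖z + w‖ ≤ ‖z‖ + ‖w‖ := by
  refine le_of_forall_pos_lt_add fun ε hε => ?_
  obtain ⟨F, x, y, rfl, rfl, hx, hy⟩ := exists_norm_lt z w
    (lt_add_of_pos_right ‖z‖ (half_pos hε)) (lt_add_of_pos_right ‖w‖ (half_pos hε))
  rw [← map_add]
  have h1 := norm_of_le (t := t) (x + y)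
  have h2 := tensorNorm_add_le t x y
  linarith

theorem norm_smul_le' (c : ℂ) (z : PreTensorPower t A J) : ‖c • z‖ ≤ ‖c‖ * ‖z‖ := by
  rcases eq_or_ne c 0 with rfl | hc
  · obtain ⟨F, x, rfl⟩ := exists_of t z
    rw [← map_smul, zero_smul, norm_zero, zero_mul]
    exact (norm_of_le _).trans_eq (tensorNorm_zero t)
  · have hc' : 0 < ‖c‖ := norm_pos_iff.2 hc
    rw [← div_le_iff₀' hc']
    refine le_norm fun F x hx => ?_
    rw [div_le_iff₀' hc', ← hx, ← map_smul, ← tensorNorm_smul]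
    exact norm_of_le _

theorem norm_mul_le' (z w : PreTensorPower t A J) : ‖z * w‖ ≤ ‖z‖ * ‖w‖ := by
  have h : ∀ ε > 0, ‖z * w‖ ≤ (‖z‖ + ε) * (‖w‖ + ε) := by
    intro ε hε
    obtain ⟨F, x, y, hz, hw, hx, hy⟩ := exists_norm_lt z w
      (lt_add_of_pos_right ‖z‖ hε) (lt_add_of_pos_right ‖w‖ hε)
    calc ‖z * w‖ = ‖of t F (x * y)‖ := by rw [map_mul, hz, hw]
      _ ≤ tensorNorm t x * tensorNorm t y := (norm_of_le _).trans (tensorNorm_mul_le t x y)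
      _ ≤ _ := mul_le_mul hx.le hy.le (tensorNorm_nonneg t y)
        ((tensorNorm_nonneg t x).trans hx.le)
  have hlim : Filter.Tendsto (fun ε : ℝ => (‖z‖ + ε) * (‖w‖ + ε)) (nhdsWithin 0 (Set.Ioi 0))
      (nhds (‖z‖ * ‖w‖)) := by
    have : Continuous fun ε : ℝ => (‖z‖ + ε) * (‖w‖ + ε) := by fun_prop
    have h0 := this.tendsto 0
    simp only [add_zero] at h0
    exact h0.mono_left nhdsWithin_le_nhds
  exact ge_of_tendsto hlim (by filter_upwards [self_mem_nhdsWithin] with ε hε using h ε hε)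

theorem norm_star_le' (z : PreTensorPower t A J) : ‖star z‖ ≤ ‖z‖ :=
  le_norm fun F x hx => by
    rw [← hx, ← map_star, ← tensorNorm_star]
    exact norm_of_le _

theorem norm_mul_self_le' (z : PreTensorPower t A J) : ‖z‖ * ‖z‖ ≤ ‖star z * z‖ := by
  refine le_norm fun F y hy => ?_
  obtain ⟨G, x, rfl⟩ := exists_of t z
  rw [← map_star, ← map_mul] at hy
  obtain ⟨K, hF, hG, h⟩ := of_eq_of t hy
  rw [← of_transition t hG x]
  calc _ ≤ _ := mul_self_le_mul_self (norm_nonneg' _) (norm_of_le _)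
    _ ≤ _ := tensorNorm_sq_le t _
    _ = tensorNorm t (transition A J F K hF y) := by rw [h, map_mul, map_star]
    _ ≤ _ := tensorNorm_transition_le _ _

instance : SeminormedRing (PreTensorPower t A J) where
  __ := SeminormedAddCommGroup.ofCore (𝕜 := ℂ)
    { norm_nonneg := norm_nonneg'
      norm_smul := fun c z => by
        refine le_antisymm (norm_smul_le' c z) ?_
        rcases eq_or_ne c 0 with rfl | hc
        · rw [norm_zero, zero_mul]
          exact norm_nonneg' _
        · have hc' : 0 < ‖c‖ := norm_pos_iff.2 hc
          have h := norm_smul_le' c⁻¹ (c • z)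
          rwa [inv_smul_smul₀ hc, norm_inv, ← div_eq_inv_mul, le_div_iff₀' hc'] at h
      norm_triangle := norm_add_le' }
  __ : Ring (PreTensorPower t A J) := inferInstance
  norm_mul_le := norm_mul_le'

instance : NormedAlgebra ℂ (PreTensorPower t A J) where
  norm_smul_le := norm_smul_le'

theorem norm_star' (z : PreTensorPower t A J) : ‖star z‖ = ‖z‖ :=
  le_antisymm (norm_star_le' z) (by simpa using norm_star_le' (star z))

theorem continuous_star' : UniformContinuous (star : PreTensorPower t A J → PreTensorPower t A J) :=
  uniformContinuous_addMonoidHom_of_continuous (f := (starAddEquiv : PreTensorPower t A J ≃+ _)) <|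
    AddMonoidHomClass.continuous_of_bound _ 1 fun z => by simp [norm_star']

variable (t) in
/-- The `*`-homomorphism which permutes the tensor factors according to `σ`: it sends the tensor
factor at `j` to the one at `σ j`. -/
def permute (σ : Equiv.Perm J) : PreTensorPower t A J →⋆ₐ[ℂ] PreTensorPower t A J :=
  have compat : ∀ (F G : Finset J) (h : F ≤ G) (x : AlgPow A F),
      of t (F.map σ.toEmbedding) (AlgPow.incl (permEmb σ F) x) =
        of t (G.map σ.toEmbedding) (AlgPow.incl (permEmb σ G) (transition A J F G h x)) := by
    intro F G h x
    rw [← of_transition t (Finset.map_subset_map.2 h : F.map σ.toEmbedding ≤ G.map σ.toEmbedding)]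
    unfold transition
    rw [AlgPow.incl_incl, AlgPow.incl_incl]
    rfl
  let φ : PreTensorPower t A J → PreTensorPower t A J :=
    DirectLimit.lift (transition A J) (fun F x =>
      of t (F.map σ.toEmbedding) (AlgPow.incl (permEmb σ F) x)) compat
  have hφ : ∀ F x, φ (of t F x) = of t (F.map σ.toEmbedding) (AlgPow.incl (permEmb σ F) x) :=
    fun _ _ => rfl
  { toFun := φ
    map_one' := by rw [← map_one (of t (∅ : Finset J)), hφ, map_one, map_one, map_one]
    map_mul' := fun z w => by
      obtain ⟨F, x, y, rfl, rfl⟩ := exists_of₂ t z w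
      rw [← map_mul, hφ, hφ, hφ, map_mul, map_mul]
    map_zero' := by rw [← map_zero (of t (∅ : Finset J)), hφ, map_zero, map_zero, map_zero]
    map_add' := fun z w => by
      obtain ⟨F, x, y, rfl, rfl⟩ := exists_of₂ t z w
      rw [← map_add, hφ, hφ, hφ, map_add, map_add]
    commutes' := fun r => by
      rw [← AlgHomClass.commutes (of t (∅ : Finset J)), hφ, AlgHomClass.commutes,
        AlgHomClass.commutes, AlgHomClass.commutes]
    map_star' := fun z => by
      obtain ⟨F, x, rfl⟩ := exists_of t z
      rw [← map_star, hφ, hφ, map_star, map_star] }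

theorem permute_of (σ : Equiv.Perm J) (F : Finset J) (x : AlgPow A F) :
    permute t σ (of t F x) = of t (F.map σ.toEmbedding) (AlgPow.incl (permEmb σ F) x) := rfl

theorem norm_permute_le (σ : Equiv.Perm J) (z : PreTensorPower t A J) : ‖permute t σ z‖ ≤ ‖z‖ :=
  le_norm fun F x hx => by
    rw [← hx, permute_of]
    exact (norm_of_le _).trans (tensorNorm_incl_le t _ x)

theorem continuous_permute (σ : Equiv.Perm J) :
    Continuous (permute t σ : PreTensorPower t A J → PreTensorPower t A J) :=
  AddMonoidHomClass.continuous_of_bound _ 1 fun z => by simpa using norm_permute_le σ z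

theorem uniformContinuous_permute (σ : Equiv.Perm J) :
    UniformContinuous (permute t σ : PreTensorPower t A J → PreTensorPower t A J) :=
  uniformContinuous_addMonoidHom_of_continuous (continuous_permute σ)

end PreTensorPower

/-- The infinite tensor power `A_J` of a `C*`-algebra `A`, in the minimal or the maximal norm: the
(Hausdorff) completion of `colim_F A_F`. -/
abbrev TensorPower (t : TensorNorm) (A : Type u) [CStarAlgebra A] (J : Type v) :
    Type (max u v) :=
  UniformSpace.Completion (PreTensorPower t A J)

namespace TensorPower

open UniformSpace PreTensorPower

variable {t A J}

instance : Star (TensorPower t A J) where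
  star := Completion.map star

theorem star_coe (z : PreTensorPower t A J) :
    star (z : TensorPower t A J) = ((star z : PreTensorPower t A J) : TensorPower t A J) :=
  Completion.map_coe continuous_star' z

theorem continuous_star : Continuous (star : TensorPower t A J → TensorPower t A J) :=
  Completion.continuous_map

instance : CStarAlgebra (TensorPower t A J) where
  star_involutive x := by
    induction x using Completion.induction_on with
    | hp => exact isClosed_eq (continuous_star.comp continuous_star) continuous_id
    | ih x => rw [star_coe, star_coe, star_star]
  star_mul x y := by
    induction x, y using Completion.induction_on₂ with
    | hp =>
      exact isClosed_eq (continuous_star.comp continuous_mul)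
        ((continuous_star.comp continuous_snd).mul (continuous_star.comp continuous_fst))
    | ih x y =>
      rw [← Completion.coe_mul, star_coe, star_coe, star_coe, ← Completion.coe_mul, star_mul]
  star_add x y := by
    induction x, y using Completion.induction_on₂ with
    | hp =>
      exact isClosed_eq (continuous_star.comp continuous_add)
        ((continuous_star.comp continuous_fst).add (continuous_star.comp continuous_snd))
    | ih x y =>
      rw [← Completion.coe_add, star_coe, star_coe, star_coe, ← Completion.coe_add, star_add]
  norm_mul_self_le x := by
    induction x using Completion.induction_on with
    | hp =>
      exact isClosed_le (continuous_norm.mul continuous_norm)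
        (continuous_norm.comp (continuous_star.mul continuous_id))
    | ih x =>
      rw [star_coe, ← Completion.coe_mul, Completion.norm_coe, Completion.norm_coe]
      exact norm_mul_self_le' x
  norm_smul_le c x := norm_smul_le c x
  star_smul c x := by
    induction x using Completion.induction_on with
    | hp =>
      exact isClosed_eq (continuous_star.comp (continuous_const_smul c))
        (continuous_star.const_smul (star c))
    | ih x => rw [← Completion.coe_smul, star_coe, star_coe, star_smul, Completion.coe_smul]

variable (t A) in
/-- The `*`-homomorphism `A_σ : A_J → A_J` which permutes the tensor factors according to `σ`. -/
def permute (σ : Equiv.Perm J) : TensorPower t A J →⋆ₐ[ℂ] TensorPower t A J where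
  __ := Completion.mapRingHom (PreTensorPower.permute (A := A) t σ).toAlgHom.toRingHom
    (continuous_permute (t := t) σ)
  commutes' r := by
    change Completion.map (PreTensorPower.permute (A := A) t σ) _ = _
    rw [Completion.algebraMap_def, Completion.map_coe (uniformContinuous_permute σ),
      AlgHomClass.commutes]
  map_star' x := by
    change Completion.map (PreTensorPower.permute (A := A) t σ) _ =
      star (Completion.map (PreTensorPower.permute (A := A) t σ) _)
    induction x using Completion.induction_on with
    | hp =>
      exact isClosed_eq (Completion.continuous_map.comp continuous_star)
        (continuous_star.comp Completion.continuous_map)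
    | ih x =>
      rw [star_coe, Completion.map_coe (uniformContinuous_permute σ),
        Completion.map_coe (uniformContinuous_permute σ), map_star, star_coe]

theorem permute_coe (σ : Equiv.Perm J) (z : PreTensorPower t A J) :
    permute t A σ z = (PreTensorPower.permute t σ z : TensorPower t A J) :=
  Completion.map_coe (uniformContinuous_permute σ) z

end TensorPower
end Infinite

end

end CStarTensor

/-! An invariant element is close to an element `y` of some finite tensor power `A_F`. Since `J` is
infinite, a finite permutation `σ` moves `F` to a set disjoint from `F`. Invariance of `x` makes `y`
and `σ y` close to each other. Let a state `φ` of `A` act on all tensor factors outside `F` and the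
identity on those in `F`. This slice map fixes `y`, and it sends `σ y` to a scalar because `σ y` is
`1` on every factor in `F`. Hence `y` is close to a scalar, and so is `x`; the line spanned by `1`
is closed.

The analytic content is that slicing is bounded, uniformly in the finite index sets, for both norms
(`tensorNorm_slice_le`). Here `φ` is a vector functional of a representation, and it suffices to
bound the functionals `⟪ξ, R(slice z) ξ⟫`, since numerical radii control operator norms up to a
factor 2. For the maximal norm such a functional is positive by the Schur product theorem
(`vectorState_slice_nonneg`), so the GNS construction realises it in some representation of the
larger tensor power. For the minimal norm it is realised in a tensor product of representations, by
tensoring `ξ` with the vectors that implement `φ` (`exists_inner_preRep_slice`).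

`PreTensorPower.norm_of_sub_smul_one_le` is the resulting estimate in the colimit, and
`TensorPower.exists_norm_sub_smul_one_le` passes it to the completion. The zero algebra, which has
no state, is treated separately. -/

namespace CStarTensor

open scoped TensorProduct ComplexConjugate ComplexOrder
open Function UniformSpace
open PiTensorProduct hiding tprod

universe u v w

/-! ### The GNS construction for *-algebras spanned by unitaries. -/

section GNS

variable {B : Type w} [Ring B] [StarRing B] [Algebra ℂ B]

/-- A `*`-representation by bounded operators on a pre-Hilbert space extends to the completion. -/
noncomputable def HilbertRep.ofPreHilbert {E : Type u} [SeminormedAddCommGroup E]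
    [InnerProductSpace ℂ E] (π : B →ₐ[ℂ] Module.End ℂ E)
    (hadj : ∀ b ξ η, inner ℂ ξ (π b η) = inner ℂ (π (star b) ξ) η)
    (hbdd : ∀ b, ∃ C : ℝ, ∀ ξ, ‖π b ξ‖ ≤ C * ‖ξ‖) : HilbertRep.{u} B where
  space := Completion E
  hom :=
    { toFun := fun b => ((π b).mkContinuousOfExistsBound (hbdd b)).completion
      map_one' := by
        ext c
        induction c using Completion.induction_on with
        | hp => apply isClosed_eq <;> fun_prop
        | ih c => simp
      map_mul' := fun x y => by
        ext c
        induction c using Completion.induction_on with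
        | hp => apply isClosed_eq <;> fun_prop
        | ih c => simp
      map_zero' := by
        ext c
        induction c using Completion.induction_on with
        | hp => apply isClosed_eq <;> fun_prop
        | ih c => simp [Completion.coe_zero]
      map_add' := fun x y => by
        ext c
        induction c using Completion.induction_on with
        | hp => apply isClosed_eq <;> fun_prop
        | ih c => simp [Completion.coe_add]
      commutes' := fun r => by
        ext c
        induction c using Completion.induction_on with
        | hp => apply isClosed_eq <;> fun_prop
        | ih c => simp [Algebra.algebraMap_eq_smul_one]
      map_star' := fun x => by
        refine (ContinuousLinearMap.eq_adjoint_iff _ _).mpr fun ξ η => ?_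
        induction ξ, η using Completion.induction_on₂ with
        | hp => apply isClosed_eq <;> fun_prop
        | ih ξ η =>
          simp only [ContinuousLinearMap.completion_apply_coe, Completion.inner_coe]
          exact (hadj x ξ η).symm }

theorem HilbertRep.ofPreHilbert_hom_coe {E : Type u} [SeminormedAddCommGroup E]
    [InnerProductSpace ℂ E] (π : B →ₐ[ℂ] Module.End ℂ E)
    (hadj : ∀ b ξ η, inner ℂ ξ (π b η) = inner ℂ (π (star b) ξ) η)
    (hbdd : ∀ b, ∃ C : ℝ, ∀ ξ, ‖π b ξ‖ ≤ C * ‖ξ‖) (b : B) (ξ : E) :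
    (ofPreHilbert π hadj hbdd).hom b (ξ : Completion E) = ((π b ξ : E) : Completion E) :=
  ContinuousLinearMap.completion_apply_coe _ _

variable [StarModule ℂ B]

/-- Expanding `ω ((1 + c b)* (1 + c b))`, which is real, shows that `c ω(b) + conj c ω(b*)` is real
for every `c`. The values `c = 1` and `c = I` give the imaginary and the real part of the claim. -/
theorem map_star_of_nonneg (ω : B →ₗ[ℂ] ℂ) (hω : ∀ b, 0 ≤ ω (star b * b)) (b : B) :
    ω (star b) = conj (ω b) := by
  have h : ∀ c : ℂ, (c * ω b + conj c * ω (star b)).im = 0 := fun c => by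
    have h1 := (Complex.nonneg_iff.1 (hω (1 + c • b))).2
    have h2 := (Complex.nonneg_iff.1 (hω b)).2
    have h3 := (Complex.nonneg_iff.1 (hω 1)).2
    have e : star (1 + c • b) * (1 + c • b) =
        1 + c • b + conj c • star b + (conj c * c) • (star b * b) := by
      simp only [star_add, star_one, star_smul, mul_add, add_mul, one_mul, mul_one,
        smul_mul_smul_comm, RCLike.star_def]
      abel
    have hc : conj c * c = ((Complex.normSq c : ℝ) : ℂ) := by
      rw [mul_comm, Complex.mul_conj]
    rw [star_one, mul_one] at h3
    rw [e, hc] at h1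
    simp only [map_add, map_smul, smul_eq_mul, Complex.add_im, Complex.im_ofReal_mul, ← h2, ← h3,
      mul_zero, add_zero, zero_add] at h1
    rw [Complex.add_im, ← h1]
  have h1 := h 1
  have h2 := h Complex.I
  simp at h1 h2
  apply Complex.ext
  · simp; linarith
  · simp; linarith

/-- The Gelfand–Naimark–Segal construction for a positive functional on a `*`-algebra which is
spanned by its unitary elements. -/
theorem exists_rep_of_nonneg (hB : Submodule.span ℂ (unitary B : Set B) = ⊤)
    (ω : B →ₗ[ℂ] ℂ) (hω : ∀ b, 0 ≤ ω (star b * b)) :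
    ∃ (R : HilbertRep.{w} B) (Ω : R.space), ∀ b, inner ℂ Ω (R.hom b Ω) = ω b := by
  let core : PreInnerProductSpace.Core ℂ B :=
    { inner := fun a b => ω (star a * b)
      conj_inner_symm := fun a b => by
        rw [← map_star_of_nonneg ω hω, star_mul, star_star]
      re_inner_nonneg := fun a => (Complex.nonneg_iff.1 (hω a)).1
      add_left := fun a b c => by rw [star_add, add_mul, map_add]
      smul_left := fun a b c => by
        rw [star_smul, smul_mul_assoc, map_smul]; rfl }
  let _ : SeminormedAddCommGroup B := InnerProductSpace.Core.toSeminormedAddCommGroup (c := core)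
  let _ : InnerProductSpace ℂ B := InnerProductSpace.ofCore core
  have lmul_apply : ∀ a b : B, Algebra.lmul ℂ B a b = a * b := fun _ _ => rfl
  have inner_def : ∀ a b : B, inner ℂ a b = ω (star a * b) := fun _ _ => rfl
  -- No norm on `B` is given in advance, so boundedness comes from the unitaries: `(uξ)*(uξ) = ξ*ξ`
  -- makes left multiplication by `u` isometric for the seminorm of `ω`, and bounded operators are
  -- closed under linear combinations.
  have hbdd : ∀ b : B, ∃ C : ℝ, ∀ ξ, ‖Algebra.lmul ℂ B b ξ‖ ≤ C * ‖ξ‖ := by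
    intro b
    have hb : b ∈ Submodule.span ℂ (unitary B : Set B) := hB ▸ Submodule.mem_top
    induction hb using Submodule.span_induction with
    | mem u hu =>
      refine ⟨1, fun ξ => ?_⟩
      rw [one_mul, @norm_eq_sqrt_re_inner ℂ, @norm_eq_sqrt_re_inner ℂ _ _ _ _ ξ, inner_def,
        inner_def, lmul_apply, star_mul, mul_assoc, ← mul_assoc (star u),
        (Unitary.mem_iff.1 hu).1, one_mul]
    | zero => exact ⟨0, fun ξ => by simp⟩
    | add a b _ _ ha hb =>
      obtain ⟨C, hC⟩ := ha
      obtain ⟨D, hD⟩ := hb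
      refine ⟨C + D, fun ξ => ?_⟩
      rw [map_add, LinearMap.add_apply, add_mul]
      exact (norm_add_le _ _).trans (add_le_add (hC ξ) (hD ξ))
    | smul c a _ ha =>
      obtain ⟨C, hC⟩ := ha
      refine ⟨‖c‖ * C, fun ξ => ?_⟩
      rw [map_smul, LinearMap.smul_apply, norm_smul, mul_assoc]
      exact mul_le_mul_of_nonneg_left (hC ξ) (norm_nonneg c)
  -- The Hausdorff completion also divides out the null vectors of `ω`, so the seminorm need not be
  -- a norm.
  refine ⟨HilbertRep.ofPreHilbert (Algebra.lmul ℂ B) (fun b ξ η => ?_) hbdd,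
    ((1 : B) : Completion B), fun b => ?_⟩
  · rw [inner_def, inner_def, lmul_apply, lmul_apply, star_mul, star_star,
      mul_assoc]
  · rw [HilbertRep.ofPreHilbert_hom_coe]
    refine (Completion.inner_coe _ _).trans ?_
    rw [inner_def, star_one, one_mul, lmul_apply, mul_one]

end GNS

/-! ### Existence of states. -/

section State

variable {A : Type u} [CStarAlgebra A]

/-- Hahn–Banach provides a functional of norm one that takes the value 1 at the unit; such a
functional is automatically positive. -/
theorem exists_state (A : Type u) [CStarAlgebra A] [Nontrivial A] :
    ∃ φ : A →ₗ[ℂ] ℂ, φ 1 = 1 ∧ ∀ a, 0 ≤ φ (star a * a) := by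
  obtain ⟨g, hg, hg1⟩ := exists_dual_vector ℂ (1 : A) (by simp)
  rw [CStarRing.norm_one, RCLike.ofReal_one] at hg1
  refine ⟨g, hg1, fun a => ?_⟩
  have hle : ∀ x, ‖g x‖ ≤ ‖x‖ := fun x => by simpa [hg] using g.le_opNorm x
  set b := star a * a with hb
  have hbs : star b = b := by simp [hb]
  change 0 ≤ g b
  rw [Complex.nonneg_iff]
  constructor
  -- Real part: `0 ≤ b ≤ ‖b‖` gives `‖‖b‖ - b‖ ≤ ‖b‖`, hence `|‖b‖ - g b| ≤ ‖b‖`, which excludes a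
  -- negative real part.
  · let _ : PartialOrder A := CStarAlgebra.spectralOrder A
    let _ : StarOrderedRing A := CStarAlgebra.spectralOrderedRing A
    have hb0 : 0 ≤ b := star_mul_self_nonneg a
    have hb1 : b ≤ algebraMap ℝ A ‖b‖ := IsSelfAdjoint.le_algebraMap_norm_self hbs
    have h1 : ‖algebraMap ℝ A ‖b‖ - b‖ ≤ ‖b‖ := by
      have := CStarAlgebra.norm_le_norm_of_nonneg_of_le (sub_nonneg.2 hb1)
        (sub_le_self _ hb0)
      simpa using this
    have h2 := (hle _).trans h1
    have e : algebraMap ℝ A ‖b‖ = ((‖b‖ : ℝ) : ℂ) • (1 : A) := by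
      rw [Algebra.algebraMap_eq_smul_one, Complex.coe_smul]
    rw [e, map_sub, map_smul, hg1, smul_eq_mul, mul_one] at h2
    have h3 := (Complex.re_le_norm _).trans h2
    simp at h3
    exact h3
  -- Imaginary part: the C*-identity bounds `‖b + i s‖²` by `‖b‖² + s²`. The resulting inequality
  -- has a term `2 s (g b).im` linear in `s`, which must vanish.
  · have key : ∀ s : ℝ, ((g b).im + s) ^ 2 ≤ ‖b‖ ^ 2 + s ^ 2 := fun s => by
      have h1 : ‖b + (s * Complex.I : ℂ) • (1 : A)‖ ^ 2 ≤ ‖b‖ ^ 2 + s ^ 2 := by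
        rw [sq, ← CStarRing.norm_star_mul_self]
        have : star (b + (s * Complex.I : ℂ) • (1 : A)) * (b + (s * Complex.I : ℂ) • (1 : A)) =
            b * b + ((s ^ 2 : ℝ) : ℂ) • (1 : A) := by
          rw [star_add, star_smul, hbs, star_one, add_mul, mul_add, mul_add]
          simp only [smul_mul_assoc, mul_smul_comm, one_mul, mul_one, smul_smul]
          have e1 : star (s * Complex.I : ℂ) = -(s * Complex.I) := by simp
          rw [e1, show ((s : ℂ) * Complex.I) * -(s * Complex.I) = ((s ^ 2 : ℝ) : ℂ) by
            push_cast; linear_combination (-(s : ℂ) ^ 2) * Complex.I_sq]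
          rw [neg_smul]; abel
        rw [this]
        refine (norm_add_le _ _).trans (add_le_add ?_ ?_)
        · rw [sq]; exact norm_mul_le _ _
        · rw [norm_smul, CStarRing.norm_one, mul_one, Complex.norm_real, Real.norm_of_nonneg
            (sq_nonneg s)]
      have h2 : ‖g (b + (s * Complex.I : ℂ) • (1 : A))‖ ^ 2 ≤ ‖b‖ ^ 2 + s ^ 2 :=
        (pow_le_pow_left₀ (norm_nonneg _) (hle _) 2).trans h1
      refine le_trans ?_ h2
      rw [map_add, map_smul, hg1, smul_eq_mul, mul_one]
      rw [← sq_abs]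
      refine pow_le_pow_left₀ (abs_nonneg _) ?_ 2
      refine le_trans (le_of_eq ?_) (Complex.abs_im_le_norm _)
      simp
    by_contra hne
    have hne : (g b).im ≠ 0 := fun h => hne h.symm
    -- This `s` makes the cross term `2‖b‖²`, leaving `(g b).im² + ‖b‖² ≤ 0`.
    have := key (‖b‖ ^ 2 / (g b).im)
    have e : (g b).im * (‖b‖ ^ 2 / (g b).im) = ‖b‖ ^ 2 := by field_simp
    have : 0 < (g b).im ^ 2 := by positivity
    nlinarith [sq_nonneg ‖b‖]

/-- The slicing state is needed in vector form: its values on products `a* b` are then entries of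
Gram matrices, and its vector can be inserted as a tensor factor. -/
theorem exists_unit_vector_rep (A : Type u) [CStarAlgebra A] [Nontrivial A] :
    ∃ (R : HilbertRep.{u} A) (Ω : R.space), inner ℂ Ω Ω = (1 : ℂ) := by
  obtain ⟨φ, h1, h⟩ := exists_state A
  obtain ⟨R, Ω, hΩ⟩ := exists_rep_of_nonneg (CStarAlgebra.span_unitary A) φ h
  refine ⟨R, Ω, ?_⟩
  rw [← h1, ← hΩ 1, map_one, one_apply_eq_self]

end State

/-! ### Vector functionals and the numerical radius. -/

section VectorState

variable {B : Type w} [Ring B] [StarRing B] [Algebra ℂ B]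

/-- The vector functional `b ↦ ⟪ξ, R(b) ξ⟫` of a representation `R`. -/
noncomputable def vectorState (R : HilbertRep.{u} B) (ξ : R.space) : B →ₗ[ℂ] ℂ where
  toFun b := inner ℂ ξ (R.hom b ξ)
  map_add' a b := by rw [map_add, add_apply, inner_add_right]
  map_smul' c a := by
    rw [map_smul, smul_apply, inner_smul_right]; rfl

theorem vectorState_apply (R : HilbertRep.{u} B) (ξ : R.space) (b : B) :
    vectorState R ξ b = inner ℂ ξ (R.hom b ξ) := rfl

theorem vectorState_one (R : HilbertRep.{u} B) (ξ : R.space) :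
    vectorState R ξ 1 = inner ℂ ξ ξ := by
  rw [vectorState_apply, map_one, one_apply_eq_self]

theorem vectorState_star_mul (R : HilbertRep.{u} B) (ξ : R.space) (a b : B) :
    vectorState R ξ (star a * b) = inner ℂ (R.hom a ξ) (R.hom b ξ) := by
  rw [vectorState_apply, map_mul, map_star, ContinuousLinearMap.star_eq_adjoint,
    mul_apply_eq_comp, ContinuousLinearMap.adjoint_inner_right]

theorem norm_vectorState_le (R : HilbertRep.{u} B) (ξ : R.space) (b : B) :
    ‖vectorState R ξ b‖ ≤ ‖R.hom b‖ * ‖ξ‖ ^ 2 := by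
  rw [vectorState_apply]
  calc _ ≤ ‖ξ‖ * ‖R.hom b ξ‖ := norm_inner_le_norm _ _
    _ ≤ ‖ξ‖ * (‖R.hom b‖ * ‖ξ‖) := by gcongr; exact (R.hom b).le_opNorm ξ
    _ = _ := by ring

end VectorState

/-- A bounded operator on a complex Hilbert space is bounded by twice its numerical radius. -/
theorem opNorm_le_two_mul_of_inner_self_le {H : Type*} [NormedAddCommGroup H]
    [InnerProductSpace ℂ H] (T : H →L[ℂ] H) {C : ℝ} (hC : 0 ≤ C)
    (h : ∀ ξ, ‖inner ℂ ξ (T ξ)‖ ≤ C * ‖ξ‖ ^ 2) : ‖T‖ ≤ 2 * C := by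
  have h' : ∀ ξ, ‖inner ℂ (T ξ) ξ‖ ≤ C * ‖ξ‖ ^ 2 := fun ξ => by rw [norm_inner_symm]; exact h ξ
  -- Polarization writes the left side through four diagonal values; the parallelogram law, applied
  -- to `x, y` and to `x, I • y`, adds up their bounds.
  have key : ∀ x y, ‖inner ℂ (T y) x‖ ≤ C * (‖x‖ ^ 2 + ‖y‖ ^ 2) := fun x y => by
    have e := inner_map_polarization (T : H →ₗ[ℂ] H) x y
    simp only [ContinuousLinearMap.coe_coe] at e
    have p1 := parallelogram_law_with_norm ℂ x y
    have p2 := parallelogram_law_with_norm ℂ x (Complex.I • y)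
    have hI : ‖Complex.I • y‖ = ‖y‖ := by rw [norm_smul, Complex.norm_I, one_mul]
    rw [hI] at p2
    rw [e, norm_div, show ‖(4 : ℂ)‖ = 4 by simp, div_le_iff₀ (by norm_num)]
    have n1 := h' (x + y)
    have n2 := h' (x - y)
    have n3 := h' (x + Complex.I • y)
    have n4 := h' (x - Complex.I • y)
    have hIm : ∀ z : ℂ, ‖Complex.I * z‖ = ‖z‖ := fun z => by
      rw [norm_mul, Complex.norm_I, one_mul]
    refine (norm_sub_le _ _).trans ?_
    refine (add_le_add_left ((norm_add_le _ _).trans (add_le_add_left (norm_sub_le _ _) _)) _).trans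
      ?_
    rw [hIm, hIm]
    have s : C * ‖x + y‖ ^ 2 + C * ‖x - y‖ ^ 2 + C * ‖x + Complex.I • y‖ ^ 2 +
        C * ‖x - Complex.I • y‖ ^ 2 = C * (‖x‖ ^ 2 + ‖y‖ ^ 2) * 4 := by
      linear_combination C * p1 + C * p2
    linarith
  refine T.opNorm_le_bound (by positivity) fun y => ?_
  rcases eq_or_ne (T y) 0 with hT | hT
  · rw [hT, norm_zero]; positivity
  rcases eq_or_ne y 0 with rfl | hy
  · simp
  have hT' : 0 < ‖T y‖ := norm_pos_iff.2 hT
  have hy' : 0 < ‖y‖ := norm_pos_iff.2 hy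
  -- The multiple of `T y` is rescaled to have the norm of `y`, which makes the bound homogeneous:
  -- `‖y‖ ‖T y‖ ≤ 2 C ‖y‖²`.
  have h1 := key (((‖y‖ / ‖T y‖ : ℝ) : ℂ) • T y) y
  rw [inner_smul_right, norm_mul, norm_smul, Complex.norm_real, Real.norm_of_nonneg (by positivity),
    div_mul_cancel₀ _ hT'.ne', inner_self_eq_norm_sq_to_K, norm_pow, RCLike.norm_ofReal,
    abs_of_nonneg hT'.le] at h1
  have e : ‖y‖ / ‖T y‖ * ‖T y‖ ^ 2 = ‖y‖ * ‖T y‖ := by field_simp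
  rw [e] at h1
  refine le_of_mul_le_mul_left ?_ hy'
  linarith

theorem comp_update_apply {A ι κ : Type*} [DecidableEq ι] [DecidableEq κ] (e : ι ↪ κ) (m : κ → A) (i : ι) (x : A) :
    (fun j => update m (e i) x (e j)) = update (fun j => m (e j)) i x :=
  update_comp_eq_of_injective m e.injective i x

theorem comp_update_of_notMem {A ι κ : Type*} [DecidableEq κ] (e : ι ↪ κ) {k : κ} (hk : ¬ ∃ i, e i = k)
    (m : κ → A) (x : A) : (fun j => update m k x (e j)) = fun j => m (e j) :=
  funext fun j => update_of_ne (fun h => hk ⟨j, h⟩) _ _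

/-! ### Slice maps and their boundedness in both tensor norms. -/

section Slice

variable {A : Type u} [CStarAlgebra A] {ι κ : Type v}

theorem AlgPow.exists_sum (x : AlgPow A ι) :
    ∃ (n : ℕ) (c : Fin n → ℂ) (a : Fin n → ι → A), x = ∑ k, c k • PiTensorProduct.tprod ℂ (a k) := by
  induction x using PiTensorProduct.induction_on with
  | smul_tprod c v => exact ⟨1, fun _ => c, fun _ => v, by simp⟩
  | add x y hx hy =>
    obtain ⟨n, c, v, rfl⟩ := hx
    obtain ⟨m, d, w, rfl⟩ := hy
    exact ⟨n + m, Fin.append c d, Fin.append v w, by simp [Fin.sum_univ_add]⟩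

/-- This makes the GNS construction applicable to finite algebraic tensor powers. A unitary placed
in one factor is unitary, and the span of the unitaries is closed under products because the
unitaries are. -/
theorem AlgPow.span_unitary [Finite ι] :
    Submodule.span ℂ (unitary (AlgPow A ι) : Set (AlgPow A ι)) = ⊤ := by
  classical
  refine Submodule.eq_top_iff'.2 fun x => ?_
  induction x using AlgPow.induction_single with
  | single i a =>
    have ha : a ∈ Submodule.span ℂ (unitary A : Set A) := by
      rw [CStarAlgebra.span_unitary]; trivial
    induction ha using Submodule.span_induction with
    | mem u hu =>
      refine Submodule.subset_span (Unitary.mem_iff.2 ⟨?_, ?_⟩)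
      all_goals
        rw [singleAlgHom_apply, star_tprod, tprod_mul_tprod, one_def]
        congr 1
        ext j
        by_cases hj : j = i
        · subst hj; simp [Unitary.mem_iff.1 hu]
        · simp [hj]
    | zero => rw [map_zero]; exact Submodule.zero_mem _
    | add a b _ _ ha hb => rw [map_add]; exact Submodule.add_mem _ ha hb
    | smul c a _ ha => rw [map_smul]; exact Submodule.smul_mem _ _ ha
  | smul c x hx => exact Submodule.smul_mem _ _ hx
  | one => exact Submodule.subset_span (one_mem (unitary _))
  | add x y hx hy => exact Submodule.add_mem _ hx hy
  | mul x y hx hy =>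
    have := Submodule.mul_mem_mul hx hy
    rwa [Submodule.span_mul_span, Submonoid.coe_mul_self_eq] at this

/-- A family of representations indexed by `ι` extends along `ι ↪ κ`, with a given vector
functional at the new indices. -/
theorem exists_extend_rep (e : ι ↪ κ) (R : ι → HilbertRep.{u} A) (R₀ : HilbertRep.{u} A)
    (Ω : R₀.space) :
    ∃ (S : κ → HilbertRep.{u} A) (Θ : Π k, (S k).space), (fun i => S (e i)) = R ∧
      ∀ k, (¬ ∃ i, e i = k) → ∀ a, inner ℂ (Θ k) ((S k).hom a (Θ k)) = vectorState R₀ Ω a := by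
  -- The type of the vector depends on whether `k` lies in the range of `e`, so it is chosen after a
  -- case split; at old indices the vector is irrelevant and 0 is used.
  have h : ∀ k, ∃ θ : (extend e R (fun _ => R₀) k).space, (¬ ∃ i, e i = k) →
      ∀ a, inner ℂ θ ((extend e R (fun _ => R₀) k).hom a θ) = vectorState R₀ Ω a := fun k => by
    by_cases hk : ∃ i, e i = k
    · exact ⟨0, fun h => absurd hk h⟩
    · rw [extend_apply' _ _ _ hk]
      exact ⟨Ω, fun _ _ => rfl⟩
  choose Θ hΘ using h
  exact ⟨_, Θ, funext fun i => e.injective.extend_apply _ _ i, hΘ⟩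

theorem exists_extend_vector (e : ι ↪ κ) (S : κ → HilbertRep.{u} A) (Θ : Π k, (S k).space)
    (v : Π i, (S (e i)).space) :
    ∃ w : Π k, (S k).space, (∀ i, w (e i) = v i) ∧ ∀ k, (¬ ∃ i, e i = k) → w k = Θ k := by
  -- The transport along `e i = k` allows a choice for an arbitrary `k`; it disappears when `k` is
  -- `e i` itself.
  have h : ∀ k, ∃ θ : (S k).space, (∀ (i : ι) (h : e i = k), θ = h ▸ v i) ∧
      ((¬ ∃ i, e i = k) → θ = Θ k) := fun k => by
    by_cases hk : ∃ i, e i = k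
    · obtain ⟨i, rfl⟩ := hk
      refine ⟨v i, fun j h => ?_, fun h => absurd ⟨i, rfl⟩ h⟩
      obtain rfl := e.injective h
      rfl
    · exact ⟨Θ k, fun i h => absurd ⟨i, h⟩ hk, fun _ => rfl⟩
  choose w hw hw' using h
  exact ⟨w, fun i => hw _ i rfl, hw'⟩

variable [Fintype ι] [Fintype κ] [dκ : DecidableEq κ]

theorem prod_compl_update (φ : A →ₗ[ℂ] ℂ) (e : ι ↪ κ) (m : κ → A) (i : ι)
    (x : A) : ∏ k ∈ (Finset.univ.map e)ᶜ, φ (update m (e i) x k) =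
      ∏ k ∈ (Finset.univ.map e)ᶜ, φ (m k) :=
  Finset.prod_congr rfl fun k hk => by
    rw [update_of_ne]
    rintro rfl
    simp at hk

theorem prod_compl_update_of_notMem (φ : A →ₗ[ℂ] ℂ) (e : ι ↪ κ) {k : κ}
    (hk : ¬ ∃ i, e i = k) (m : κ → A) (x : A) :
    ∏ j ∈ (Finset.univ.map e)ᶜ, φ (update m k x j) =
      φ x * ∏ j ∈ (Finset.univ.map e)ᶜ \ {k}, φ (m j) := by
  have hk' : k ∈ (Finset.univ.map e)ᶜ := by simpa using hk
  rw [← Finset.mul_prod_erase _ _ hk', update_self, Finset.sdiff_singleton_eq_erase]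
  congr 1
  exact Finset.prod_congr rfl fun j hj => by rw [update_of_ne (Finset.ne_of_mem_erase hj)]

/-- The slice map `⨂ a k ↦ (∏_{k ∉ e(ι)} φ (a k)) ⨂ a (e i)` which applies a functional `φ` to
the tensor factors outside of the range of `e`. -/
noncomputable def slice (φ : A →ₗ[ℂ] ℂ) (e : ι ↪ κ) : AlgPow A κ →ₗ[ℂ] AlgPow A ι :=
  lift
    { toFun := fun a => (∏ k ∈ (Finset.univ.map e)ᶜ, φ (a k)) •
        (PiTensorProduct.tprod ℂ (fun i => a (e i)) : AlgPow A ι)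
      map_update_add' := by
        classical
        intro D m k x y
        -- Multilinearity is stated for an arbitrary decidability instance, while the product over
        -- the complement uses `dκ`.
        obtain rfl := Subsingleton.elim D dκ
        by_cases hk : ∃ i, e i = k
        · obtain ⟨i, rfl⟩ := hk
          simp only [comp_update_apply, prod_compl_update, MultilinearMap.map_update_add, smul_add]
        · simp only [comp_update_of_notMem e hk, prod_compl_update_of_notMem φ e hk, map_add,
            add_mul, add_smul]
      map_update_smul' := by
        classical
        intro D m k c x
        obtain rfl := Subsingleton.elim D dκ
        by_cases hk : ∃ i, e i = k
        · obtain ⟨i, rfl⟩ := hk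
          simp only [comp_update_apply, prod_compl_update, MultilinearMap.map_update_smul]
          rw [smul_comm]
        · simp only [comp_update_of_notMem e hk, prod_compl_update_of_notMem φ e hk, map_smul,
            smul_eq_mul, mul_smul] }

theorem slice_tprod (φ : A →ₗ[ℂ] ℂ) (e : ι ↪ κ) (a : κ → A) :
    slice φ e (PiTensorProduct.tprod ℂ a) = (∏ k ∈ (Finset.univ.map e)ᶜ, φ (a k)) •
      (PiTensorProduct.tprod ℂ (fun i => a (e i)) : AlgPow A ι) :=
  lift.tprod a

theorem slice_one {φ : A →ₗ[ℂ] ℂ} (hφ : φ 1 = 1) (e : ι ↪ κ) : slice φ e 1 = 1 := by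
  rw [one_def, slice_tprod]
  simp [hφ, one_def, Pi.one_def]

/-- Only inserted units are sliced off, and each contributes `φ 1 = 1`. -/
theorem slice_incl {φ : A →ₗ[ℂ] ℂ} (hφ : φ 1 = 1) (e : ι ↪ κ) (x : AlgPow A ι) :
    slice φ e (AlgPow.incl e x) = x := by
  classical
  induction x using PiTensorProduct.induction_on with
  | smul_tprod c a =>
    have h2 : ∀ k ∈ (Finset.univ.map e)ᶜ, φ (extend e a 1 k) = 1 := fun k hk => by
      rw [extend_apply', Pi.one_apply, hφ]
      rintro ⟨i, rfl⟩
      simp at hk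
    simp only [map_smul, AlgPow.incl_tprod, slice_tprod, e.injective.extend_apply]
    rw [Finset.prod_eq_one (fun k hk => h2 k (by convert! hk)), one_smul]
  | add x y hx hy => rw [map_add, map_add, hx, hy]

/-- On elementary tensors every factor that survives the slicing is an inserted unit, so all the
information is absorbed into a scalar. -/
theorem exists_slice_incl_of_disjoint (φ : A →ₗ[ℂ] ℂ) {ι' : Type v} (e : ι ↪ κ)
    (e' : ι' ↪ κ) (h : ∀ i j, e i ≠ e' j) (x : AlgPow A ι') :
    ∃ c : ℂ, slice φ e (AlgPow.incl e' x) = c • 1 := by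
  induction x using PiTensorProduct.induction_on with
  | smul_tprod c a =>
    have : (fun i => extend e' a 1 (e i)) = (1 : ι → A) := by
      ext i
      rw [extend_apply' _ _ _ (by rintro ⟨j, hj⟩; exact h i j hj.symm)]; rfl
    rw [map_smul, map_smul, AlgPow.incl_tprod, slice_tprod, this, ← one_def, smul_smul]
    exact ⟨_, rfl⟩
  | add x y hx hy =>
    obtain ⟨c, hc⟩ := hx
    obtain ⟨d, hd⟩ := hy
    exact ⟨c + d, by rw [map_add, map_add, hc, hd, add_smul]⟩

/-- For `z = ∑ c k • ⨂ a k` the value is the quadratic form at `c` of an entrywise product of Gram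
matrices: one of the vectors `R(⨂ a k (e i)) ξ`, and one of the vectors `R₀(a k j) Ω` for each
sliced index `j`. The Schur product theorem makes it nonnegative. -/
theorem vectorState_slice_nonneg (R : HilbertRep.{w} (AlgPow A ι)) (ξ : R.space)
    (R₀ : HilbertRep.{u} A) (Ω : R₀.space) (e : ι ↪ κ) (z : AlgPow A κ) :
    0 ≤ vectorState R ξ (slice (vectorState R₀ Ω) e (star z * z)) := by
  classical
  obtain ⟨n, c, a, rfl⟩ := AlgPow.exists_sum z
  have h := ((Matrix.posSemidef_gram ℂ fun k =>
      R.hom (PiTensorProduct.tprod ℂ fun i => a k (e i)) ξ).hadamard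
    (posSemidef_prod_gram (K := fun _ => R₀.space) (Finset.univ.map e)ᶜ
      (fun k i => R₀.hom (a k i) Ω))).dotProduct_mulVec_nonneg c
  refine h.trans_eq ?_
  have hkl : ∀ k l, vectorState R ξ (slice (vectorState R₀ Ω) e
      (star (PiTensorProduct.tprod ℂ (a k) : AlgPow A κ) * PiTensorProduct.tprod ℂ (a l))) =
      inner ℂ (R.hom (PiTensorProduct.tprod ℂ fun i => a k (e i)) ξ)
        (R.hom (PiTensorProduct.tprod ℂ fun i => a l (e i)) ξ) *
      ∏ i ∈ (Finset.univ.map e)ᶜ, inner ℂ (R₀.hom (a k i) Ω) (R₀.hom (a l i) Ω) := fun k l => by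
    rw [star_tprod, tprod_mul_tprod, slice_tprod, map_smul, ← vectorState_star_mul, star_tprod,
      tprod_mul_tprod, smul_eq_mul, mul_comm]
    simp only [← vectorState_star_mul]
    congr!
  simp only [star_sum, Finset.sum_mul, Finset.mul_sum, map_sum, star_smul, smul_mul_smul_comm,
    map_smul, hkl, dotProduct, Matrix.mulVec, Matrix.hadamard, Matrix.of_apply,
    Matrix.gram_apply, Pi.star_apply, smul_eq_mul]
  rw [Finset.sum_comm]
  refine Finset.sum_congr rfl fun k _ => Finset.sum_congr rfl fun l _ => ?_
  ring

/-- The sliced functional is positive, so GNS turns it into a vector functional of a representation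
of the larger tensor power. The maximal norm dominates every such representation. -/
theorem norm_vectorState_slice_le_max (R : HilbertRep.{max u v} (AlgPow A ι)) (ξ : R.space)
    {R₀ : HilbertRep.{u} A} {Ω : R₀.space} (hΩ : inner ℂ Ω Ω = (1 : ℂ)) (e : ι ↪ κ)
    (z : AlgPow A κ) :
    ‖vectorState R ξ (slice (vectorState R₀ Ω) e z)‖ ≤ tensorNorm .max z * ‖ξ‖ ^ 2 := by
  obtain ⟨S, η, hη⟩ := exists_rep_of_nonneg (AlgPow.span_unitary (A := A) (ι := κ))
    ((vectorState R ξ).comp (slice (vectorState R₀ Ω) e))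
    (vectorState_slice_nonneg R ξ R₀ Ω e)
  change ∀ b, _ = vectorState R ξ (slice (vectorState R₀ Ω) e b) at hη
  -- Evaluating at the unit, which slicing preserves, shows that the GNS vector `η` has the norm of
  -- `ξ`.
  have h1 := hη 1
  rw [slice_one ((vectorState_one R₀ Ω).trans hΩ), vectorState_one, map_one,
    one_apply_eq_self, inner_self_eq_norm_sq_to_K, inner_self_eq_norm_sq_to_K] at h1
  have h2 : ‖η‖ ^ 2 = ‖ξ‖ ^ 2 := by exact_mod_cast h1
  rw [← hη, ← h2]
  exact (norm_vectorState_le S η z).trans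
    (mul_le_mul_of_nonneg_right (norm_le_tensorNorm .max trivial z) (by positivity))

/-- Arbitrary GNS representations are of no use for the minimal norm, so the functional is realised
inside a tensor product representation: `η` is `ξ` tensored with `Θ k` at the new indices, whose
inner products reproduce `φ`. -/
theorem exists_inner_preRep_slice (e : ι ↪ κ) (S : κ → HilbertRep.{u} A) (Θ : Π k, (S k).space)
    (φ : A →ₗ[ℂ] ℂ)
    (hΘ : ∀ k, (¬ ∃ i, e i = k) → ∀ a, inner ℂ (Θ k) ((S k).hom a (Θ k)) = φ a)
    (ξ : PreHilbertTensor fun i => (S (e i)).space) :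
    ∃ η : PreHilbertTensor fun k => (S k).space, ∀ z : AlgPow A κ,
      inner ℂ η (preRep S z η) = inner ℂ ξ (preRep (fun i => S (e i)) (slice φ e z) ξ) := by
  classical
  obtain ⟨n, c, v, rfl⟩ := PreHilbertTensor.exists_sum ξ
  choose w hw hw' using fun k => exists_extend_vector e S Θ (v k)
  have hkl : ∀ k l (z : AlgPow A κ), inner ℂ (PreHilbertTensor.mk (w k))
      (preRep S z (PreHilbertTensor.mk (w l))) = inner ℂ (PreHilbertTensor.mk (v k))
        (preRep (fun i => S (e i)) (slice φ e z) (PreHilbertTensor.mk (v l))) := fun k l z => by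
    induction z using PiTensorProduct.induction_on with
    | smul_tprod d a =>
      simp only [map_smul, LinearMap.smul_apply, slice_tprod, preRep_tprod_mk,
        inner_smul_right, PreHilbertTensor.inner_mk]
      rw [prod_split e, mul_comm (∏ i, _)]
      congr 2
      · refine Finset.prod_congr (by congr!) fun j hj => ?_
        have hj : ¬ ∃ i, e i = j := by simpa using hj
        rw [hw' k j hj, hw' l j hj, hΘ j hj]
      · simp only [hw]
    | add x y hx hy => simp only [map_add, LinearMap.add_apply, inner_add_right, hx, hy]
  refine ⟨∑ k, c k • PreHilbertTensor.mk (w k), fun z => ?_⟩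
  simp only [map_sum, map_smul, sum_inner, inner_sum, inner_smul_left, inner_smul_right, hkl]

theorem spatialRep_hom_coe (R : ι → HilbertRep.{u} A) (x : AlgPow A ι)
    (ξ : PreHilbertTensor fun i => (R i).space) :
    (spatialRep R).hom x (ξ : HilbertTensor fun i => (R i).space) =
      ((preRep R x ξ : PreHilbertTensor fun i => (R i).space) :
        HilbertTensor fun i => (R i).space) :=
  ContinuousLinearMap.completion_apply_coe (preRepL R x) ξ

theorem vectorState_spatialRep_coe (R : ι → HilbertRep.{u} A) (x : AlgPow A ι)
    (ξ : PreHilbertTensor fun i => (R i).space) :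
    vectorState (spatialRep R) (ξ : HilbertTensor fun i => (R i).space) x =
      inner ℂ ξ (preRep R x ξ) :=
  (congrArg (inner ℂ (ξ : HilbertTensor fun i => (R i).space)) (spatialRep_hom_coe R x ξ)).trans
    (Completion.inner_coe _ _)

theorem norm_vectorState_slice_le_min (R : ι → HilbertRep.{u} A) (ξ : (spatialRep R).space)
    {R₀ : HilbertRep.{u} A} {Ω : R₀.space} (hΩ : inner ℂ Ω Ω = (1 : ℂ)) (e : ι ↪ κ)
    (z : AlgPow A κ) :
    ‖vectorState (spatialRep R) ξ (slice (vectorState R₀ Ω) e z)‖ ≤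
      tensorNorm .min z * ‖ξ‖ ^ 2 := by
  induction ξ using Completion.induction_on with
  | hp =>
    change IsClosed {ξ : (spatialRep R).space |
      ‖(inner ℂ ξ ((spatialRep R).hom (slice (vectorState R₀ Ω) e z) ξ) : ℂ)‖ ≤
        tensorNorm .min z * ‖ξ‖ ^ 2}
    apply isClosed_le <;> fun_prop
  | ih ξ =>
    -- Since `R` is a variable, it can be replaced by the restriction of `S`, so no identification
    -- of Hilbert spaces is needed.
    obtain ⟨S, Θ, rfl, hΘ⟩ := exists_extend_rep e R R₀ Ω
    obtain ⟨η, hη⟩ := exists_inner_preRep_slice e S Θ _ hΘ ξ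
    have h1 := hη 1
    rw [slice_one ((vectorState_one R₀ Ω).trans hΩ), map_one, map_one, Module.End.one_apply,
      Module.End.one_apply, inner_self_eq_norm_sq_to_K, inner_self_eq_norm_sq_to_K] at h1
    have h2 : ‖η‖ ^ 2 = ‖ξ‖ ^ 2 := by exact_mod_cast h1
    have h3 : ‖(ξ : HilbertTensor fun i => (S (e i)).space)‖ = ‖ξ‖ := Completion.norm_coe ξ
    have h4 : ‖(η : HilbertTensor fun i => (S i).space)‖ = ‖η‖ := Completion.norm_coe η
    refine le_of_le_of_eq ?_ (congrArg (fun r => tensorNorm .min z * r ^ 2) h3.symm)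
    rw [vectorState_spatialRep_coe, ← hη, ← vectorState_spatialRep_coe, ← h2, ← h4]
    exact (norm_vectorState_le (spatialRep S) _ z).trans
      (mul_le_mul_of_nonneg_right (norm_le_tensorNorm .min ⟨S, rfl⟩ z) (by positivity))

/-- The factor 2 is the price of testing operators on the diagonal only. Any constant independent of
the index sets serves the application. -/
theorem tensorNorm_slice_le (t : TensorNorm)
    {R₀ : HilbertRep.{u} A} {Ω : R₀.space} (hΩ : inner ℂ Ω Ω = (1 : ℂ)) (e : ι ↪ κ)
    (z : AlgPow A κ) :
    tensorNorm t (slice (vectorState R₀ Ω) e z) ≤ 2 * tensorNorm t z :=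
  ciSup_le fun R => by
    obtain ⟨R, hR⟩ := R
    refine opNorm_le_two_mul_of_inner_self_le _ (tensorNorm_nonneg t z) fun ξ => ?_
    cases t with
    | min =>
      obtain ⟨S, rfl⟩ := hR
      exact norm_vectorState_slice_le_min S ξ hΩ e z
    | max => exact norm_vectorState_slice_le_max R ξ hΩ e z

end Slice

/-! ### Moving finite index sets apart, and approximation by scalars. -/

/-- A finite set in an infinite type can be moved off a finite set by a finite permutation. -/
theorem exists_perm_disjoint_map {J : Type v} [Infinite J] (S F : Finset J) :
    ∃ σ : Equiv.Perm J, {j | σ j ≠ j}.Finite ∧ Disjoint S (F.map σ.toEmbedding) := by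
  classical
  induction F using Finset.induction_on with
  | empty => exact ⟨1, by simp, by simp⟩
  | insert i F hi ih =>
    obtain ⟨σ, hσ, hd⟩ := ih
    -- Swapping `σ i` with a fresh `k` sends `i` off `S`; as `k` also avoids `σ(F)`, the images of
    -- the points of `F` do not change.
    obtain ⟨k, hk⟩ := Infinite.exists_notMem_finset (S ∪ F.map σ.toEmbedding)
    rw [Finset.notMem_union] at hk
    refine ⟨Equiv.swap (σ i) k * σ, (hσ.union (Set.toFinite {i, σ.symm k})).subset fun j hj => ?_,
      Finset.disjoint_right.2 fun l hl => ?_⟩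
    · by_contra! hcon
      simp only [Set.mem_union, Set.mem_ofPred_eq, Set.mem_insert_iff, Set.mem_singleton_iff,
        not_or, not_not, Equiv.eq_symm_apply] at hcon
      refine hj ?_
      rw [Equiv.Perm.mul_apply,
        Equiv.swap_apply_of_ne_of_ne (fun h => hcon.2.1 (σ.injective h)) hcon.2.2, hcon.1]
    · obtain ⟨j, hj, rfl⟩ := Finset.mem_map.1 hl
      change Equiv.swap (σ i) k (σ j) ∉ S
      rcases Finset.mem_insert.1 hj with rfl | hj
      · rw [Equiv.swap_apply_left]; exact hk.1
      · have hm : σ j ∈ F.map σ.toEmbedding := Finset.mem_map_of_mem _ hj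
        have h1 : σ j ≠ σ i := fun h => hi (by rwa [← σ.injective h])
        have h2 : σ j ≠ k := fun h => hk.2 (by rwa [← h])
        rw [Equiv.swap_apply_of_ne_of_ne h1 h2]
        exact Finset.disjoint_right.1 hd hm

variable {t : TensorNorm} {A : Type u} [CStarAlgebra A] {J : Type v}

theorem TensorPower.norm_permute_le (σ : Equiv.Perm J) (x : TensorPower t A J) :
    ‖TensorPower.permute t A σ x‖ ≤ ‖x‖ :=
  NonUnitalStarAlgHom.norm_apply_le (TensorPower.permute t A σ) x

/-- Slicing down to `F` sends `x - σ x` to `x - c • 1`, because `σ x` lives on factors disjoint from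
`F`. Boundedness of the slice gives the estimate. -/
theorem PreTensorPower.norm_of_sub_smul_one_le [Nontrivial A] {F : Finset J} (σ : Equiv.Perm J)
    (hσ : Disjoint F (F.map σ.toEmbedding)) (x : AlgPow A F) {r : ℝ}
    (hr : ‖PreTensorPower.of t F x - PreTensorPower.permute t σ (PreTensorPower.of t F x)‖ < r) :
    ∃ c : ℂ, ‖PreTensorPower.of t F x - c • 1‖ ≤ 2 * r := by
  classical
  obtain ⟨R₀, Ω, hΩ⟩ := exists_unit_vector_rep A
  have hφ : vectorState R₀ Ω 1 = 1 := (vectorState_one R₀ Ω).trans hΩ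
  rw [PreTensorPower.permute_of] at hr
  set F' := F.map σ.toEmbedding
  set x' : AlgPow A F' := AlgPow.incl (permEmb σ F) x
  -- The norm is an infimum over representatives, so a good representative `y` of the difference may
  -- involve indices unrelated to `F`. It agrees with the explicit one only in a larger `A_K`, where
  -- the slicing takes place.
  obtain ⟨G, y, -, hy, -, hyr, -⟩ := PreTensorPower.exists_norm_lt _ _ hr hr
  rw [← PreTensorPower.of_transition t (le_sup_left : F ≤ F ⊔ F'),
    ← PreTensorPower.of_transition t (le_sup_right : F' ≤ F ⊔ F'), ← map_sub] at hy
  obtain ⟨K, hG, hK, e⟩ := PreTensorPower.of_eq_of t hy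
  have e' : transition A J G K hG y =
      AlgPow.incl (subEmb (le_sup_left.trans hK : F ≤ K)) x -
        AlgPow.incl (subEmb (le_sup_right.trans hK : F' ≤ K)) x' := by
    rw [e, map_sub]
    unfold transition
    rw [AlgPow.incl_incl, AlgPow.incl_incl]
    rfl
  obtain ⟨c, hc⟩ := exists_slice_incl_of_disjoint (vectorState R₀ Ω)
    (subEmb (le_sup_left.trans hK : F ≤ K)) (subEmb (le_sup_right.trans hK : F' ≤ K))
    (fun i j h => Finset.disjoint_left.1 hσ i.2 (by
      have : i.1 = j.1 := congrArg (fun k : K => k.1) h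
      rw [this]; exact j.2)) x'
  refine ⟨c, ?_⟩
  have h1 := tensorNorm_slice_le t hΩ (subEmb (le_sup_left.trans hK : F ≤ K))
    (transition A J G K hG y)
  rw [e', map_sub, slice_incl hφ, hc, ← e'] at h1
  calc ‖PreTensorPower.of t F x - c • 1‖ = ‖PreTensorPower.of t F (x - c • 1)‖ := by
        rw [map_sub, map_smul, map_one]
    _ ≤ tensorNorm t (x - c • 1) := PreTensorPower.norm_of_le _
    _ ≤ 2 * tensorNorm t (transition A J G K hG y) := h1
    _ ≤ 2 * r := by
        have := PreTensorPower.tensorNorm_transition_le (t := t) hG y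
        linarith

/-- An index is needed because the empty tensor power is `ℂ` even when `A` is zero. -/
theorem PreTensorPower.one_eq_zero_of_subsingleton [Subsingleton A] [Nonempty J] :
    (1 : PreTensorPower t A J) = 0 := by
  obtain ⟨j⟩ := ‹Nonempty J›
  have h : (1 : AlgPow A ({j} : Finset J)) = 0 := by
    rw [one_def]
    exact MultilinearMap.map_coord_zero _ (⟨j, Finset.mem_singleton_self j⟩ : ({j} : Finset J))
      (Subsingleton.elim _ _)
  rw [← map_one (PreTensorPower.of t ({j} : Finset J)), h, map_zero]

theorem TensorPower.exists_norm_sub_smul_one_le [Nontrivial A] [Infinite J]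
    (x : TensorPower t A J)
    (hx : ∀ σ : Equiv.Perm J, {j | σ j ≠ j}.Finite → TensorPower.permute t A σ x = x)
    {ε : ℝ} (hε : 0 < ε) : ∃ c : ℂ, ‖x - c • 1‖ < ε := by
  -- Error budget in units of `ε / 6`: the difference `w - σ w` costs 2, slicing doubles it to 4,
  -- and replacing `w` by `x` adds 1.
  have hε' : 0 < ε / 6 := by positivity
  obtain ⟨z, hz⟩ := Metric.denseRange_iff.1
    (Completion.denseRange_coe (α := PreTensorPower t A J)) x _ hε'
  rw [dist_eq_norm] at hz
  obtain ⟨F, y, rfl⟩ := PreTensorPower.exists_of t z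
  obtain ⟨σ, hσ, hd⟩ := exists_perm_disjoint_map F F
  have h1 : ‖PreTensorPower.of t F y - PreTensorPower.permute t σ (PreTensorPower.of t F y)‖ <
      2 * (ε / 6) := by
    rw [← Completion.norm_coe, Completion.coe_sub, ← TensorPower.permute_coe]
    set w : TensorPower t A J := ↑(PreTensorPower.of t F y)
    -- Invariance of `x` enters only here.
    have e : w - TensorPower.permute t A σ w = TensorPower.permute t A σ (x - w) - (x - w) := by
      rw [map_sub, hx σ hσ]; abel
    rw [e]
    have := (norm_sub_le (TensorPower.permute t A σ (x - w)) (x - w))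
    have := TensorPower.norm_permute_le σ (x - w)
    linarith
  obtain ⟨c, hc⟩ := PreTensorPower.norm_of_sub_smul_one_le σ hd y h1
  refine ⟨c, ?_⟩
  rw [← Completion.norm_coe, Completion.coe_sub, Completion.coe_smul, Completion.coe_one] at hc
  set w : TensorPower t A J := ↑(PreTensorPower.of t F y)
  have := norm_sub_le_norm_sub_add_norm_sub x w (c • 1)
  linarith

end CStarTensor

theorem propositionA1 (t : CStarTensor.TensorNorm) {A : Type*} [CStarAlgebra A]
    {J : Type*} [Infinite J] (x : CStarTensor.TensorPower t A J)
    (hx : ∀ σ : Equiv.Perm J, {j | σ j ≠ j}.Finite →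
      CStarTensor.TensorPower.permute t A σ x = x) :
    ∃ c : ℂ, x = c • (1 : CStarTensor.TensorPower t A J) := by
  rcases subsingleton_or_nontrivial A with hA | hA
  · refine ⟨0, ?_⟩
    have h : (1 : CStarTensor.TensorPower t A J) = 0 := by
      rw [← UniformSpace.Completion.coe_one,
        CStarTensor.PreTensorPower.one_eq_zero_of_subsingleton, UniformSpace.Completion.coe_zero]
    rw [zero_smul, ← mul_one x, h, mul_zero]
  -- The approximating scalars depend on `ε`; closedness of the finite-dimensional span of `1`
  -- replaces an argument that they converge.
  · have hclosed : IsClosed ((ℂ ∙ (1 : CStarTensor.TensorPower t A J) :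
        Submodule ℂ (CStarTensor.TensorPower t A J)) : Set (CStarTensor.TensorPower t A J)) :=
      Submodule.closed_of_finiteDimensional _
    have hmem : x ∈ (ℂ ∙ (1 : CStarTensor.TensorPower t A J)) := by
      refine hclosed.closure_subset (Metric.mem_closure_iff.2 fun ε hε => ?_)
      obtain ⟨c, hc⟩ := CStarTensor.TensorPower.exists_norm_sub_smul_one_le x hx hε
      exact ⟨_, Submodule.smul_mem _ c (Submodule.mem_span_singleton_self 1),
        by rwa [dist_eq_norm]⟩
    obtain ⟨c, hc⟩ := Submodule.mem_span_singleton.1 hmem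
    exact ⟨c, hc.symm⟩
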